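/- All rings are commutative with identity. For a ring $R$ and an $R$-module $M$: - The cotorsion dimension $\mathrm{cd}_R(M)$ is the least integer $n\ge 0$ with $\mathrm{Ext}_R^{n+1}(F,M)=0$ for all flat $R$-modules $F$ (and $\infty$ if there is none), and $\mathrm{cot.D}(R)$ is the supremum of $\mathrm{cd}_R(M)$ over all $R$-modules $M$. - $M$ is Gorenstein projective if $M\cong \mathrm{Im}(P_0\to P_1)$ for some exact sequence of projective modules $\cdots\to P_{-1}\to P_0\to P_1\to\cdots$ that stays exact under $\mathrm{Hom}_R(-,Q)$ for every projective module $Q$. $M$ is Gorenstein flat if $M\cong \mathrm{Im}(F_0\to F_1)$ for some exact sequence of flat modules $\cdots\to F_{-1}\to F_0\to F_1\to\cdots$ that stays exact under $I\otimes_R-$ for every injective module $I$. - $\mathrm{Gpd}_R(M)$ (resp. $\mathrm{Gfd}_R(M)$) is the least $n\ge 0$ for which there is an exact sequence $0\to G_n\to\cdots\to G_0\to M\to 0$ with all $G_i$ Gorenstein projective (resp. Gorenstein flat), and $\infty$ if there is none. $\mathrm{G\text{-}gldim}(R)$ and $\mathrm{G\text{-}wdim}(R)$ are the suprema of $\mathrm{Gpd}_R(M)$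 and of $\mathrm{Gfd}_R(M)$, respectively, over all $R$-modules $M$. **Theorem.** For every ring $R$, $$\mathrm{cot.D}(R)\le \mathrm{G\text{-}gldim}(R).$$ If $R$ is coherent (every finitely generated ideal is finitely presented), then $$\mathrm{cot.D}(R)\le \mathrm{G\text{-}gldim}(R)\le \mathrm{G\text{-}wdim}(R)+\mathrm{cot.D}(R).$$ In particular, for $R$ coherent: - If $\mathrm{cot.D}(R)=0$, equivalently if $R$ is perfect (every flat $R$-module is projective), then $\mathrm{G\text{-}wdim}(R)=\mathrm{G\text{-}gldim}(R)$. - If $\mathrm{G\text{-}wdim}(R)=0$, equivalently if $R$ is an IF-ring (every injective $R$-module is flat), then $\mathrm{cot.D}(R)=\mathrm{G\text{-}gldim}(R)$. -/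

import Mathlib

open CategoryTheory

universe u

noncomputable section

namespace GorensteinDim

variable {R : Type u} [CommRing R]

/-- `M` is Gorenstein projective: there is an exact sequence of projective modules
`⋯ → P (-1) → P 0 → P 1 → ⋯`, which stays exact under `Hom(-, Q)` for every projective module `Q`,
and `M` is isomorphic to the image of `P 0 → P 1`. -/
def IsGorensteinProjective (M : ModuleCat.{u} R) : Prop :=
  ∃ (P : ℤ → ModuleCat.{u} R) (d : ∀ i, P i →ₗ[R] P (i + 1)),
    (∀ i, Module.Projective R (P i)) ∧
    (∀ i, Function.Exact (d i) (d (i + 1))) ∧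
    (∀ Q : ModuleCat.{u} R, Module.Projective R Q →
      ∀ i, Function.Exact (LinearMap.lcomp R Q (d (i + 1))) (LinearMap.lcomp R Q (d i))) ∧
    Nonempty (M ≃ₗ[R] LinearMap.range (d 0))

/-- `M` is Gorenstein flat: there is an exact sequence of flat modules
`⋯ → F (-1) → F 0 → F 1 → ⋯`, which stays exact under `I ⊗ -` for every injective module `I`,
and `M` is isomorphic to the image of `F 0 → F 1`. -/
def IsGorensteinFlat (M : ModuleCat.{u} R) : Prop :=
  ∃ (F : ℤ → ModuleCat.{u} R) (d : ∀ i, F i →ₗ[R] F (i + 1)),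
    (∀ i, Module.Flat R (F i)) ∧
    (∀ i, Function.Exact (d i) (d (i + 1))) ∧
    (∀ I : ModuleCat.{u} R, Module.Injective R I →
      ∀ i, Function.Exact (LinearMap.lTensor I (d i)) (LinearMap.lTensor I (d (i + 1)))) ∧
    Nonempty (M ≃ₗ[R] LinearMap.range (d 0))

/-- For an isomorphism-closed class `C` of modules: there is an exact sequence
`0 → Gₙ → ⋯ → G₁ → G₀ → M → 0` with every `Gᵢ` in `C`
(obtained by splicing short exact sequences `0 → K → G₀ → M → 0`). -/
def HasResolution (C : ModuleCat.{u} R → Prop) : ℕ → ModuleCat.{u} R → Prop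
  | 0, M => C M
  | n + 1, M => ∃ (G K : ModuleCat.{u} R) (f : K →ₗ[R] G) (g : G →ₗ[R] M),
      C G ∧ HasResolution C n K ∧
      Function.Injective f ∧ Function.Exact f g ∧ Function.Surjective g

/-- The Gorenstein projective dimension `Gpd_R(M)`, with value `⊤` if there is no finite resolution
of `M` by Gorenstein projective modules. -/
def Gpd (M : ModuleCat.{u} R) : ℕ∞ :=
  ⨅ (n : ℕ) (_ : HasResolution IsGorensteinProjective n M), (n : ℕ∞)

/-- The Gorenstein flat dimension `Gfd_R(M)`. -/
def Gfd (M : ModuleCat.{u} R) : ℕ∞ :=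
  ⨅ (n : ℕ) (_ : HasResolution IsGorensteinFlat n M), (n : ℕ∞)

/-- The cotorsion dimension `cd_R(M)`: the least `n ≥ 0` with `Ext^{n+1}_R(F, M) = 0` for all
flat modules `F`, and `⊤` if there is none. -/
def cd (M : ModuleCat.{u} R) : ℕ∞ :=
  ⨅ (n : ℕ) (_ : ∀ F : ModuleCat.{u} R, Module.Flat R F →
    Subsingleton (Abelian.Ext.{u} F M (n + 1))), (n : ℕ∞)

variable (R)

/-- The Gorenstein global dimension `G-gldim(R)`. -/
def Ggldim : ℕ∞ := ⨆ M : ModuleCat.{u} R, Gpd M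

/-- The Gorenstein weak global dimension `G-wdim(R)`. -/
def Gwdim : ℕ∞ := ⨆ M : ModuleCat.{u} R, Gfd M

/-- The global cotorsion dimension `cot.D(R)`. -/
def cotD : ℕ∞ := ⨆ M : ModuleCat.{u} R, cd M

/-- A coherent ring: every finitely generated ideal is finitely presented. -/
def IsCoherent : Prop := ∀ I : Ideal R, I.FG → Module.FinitePresentation R I

/-- A perfect ring (in the sense of Bass): every flat module is projective. -/
def IsPerfect : Prop := ∀ F : ModuleCat.{u} R, Module.Flat R F → Module.Projective R F

/-- An IF-ring: every injective module is flat. -/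
def IsIF : Prop := ∀ I : ModuleCat.{u} R, Module.Injective R I → Module.Flat R I

end GorensteinDim

end

/-!
The two inequalities are statements about projective dimensions. Shifting along syzygies,
`cotD R ≤ n` says that every flat module has projective dimension at most `n` (`cotD_le_iff`). The
condition `Ggldim R ≤ n` is equivalent to `pd I ≤ n` for every injective module `I`. What remains is
a comparison of flat and injective modules.

*If `Ggldim R ≤ n`, then `pd I ≤ n` for `I` injective* (`pdLE_of_isInj`). A module with a Gorenstein
projective resolution of length `n` embeds into a module of projective dimension at most `n`
(`exists_ses_of_hasResolution`), and an injective module is a direct summand of it.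

*If `pd I ≤ n` for every injective `I`, then `pd F ≤ n` for every flat `F`* (`pdLE_of_flat`). Embed
`F` in an injective module, the cokernel in another one, and so on, and pass to `n`-th syzygies by
the horseshoe lemma. The injective modules become projective, so that the `n`-th syzygy `K` of `F`
starts an exact sequence of projective modules which is infinite to the right, and a free resolution
of `K` continues it to the left. All the kernels are flat: `K` is flat, and a cokernel `C` of a
monomorphism of flat modules is flat as soon as `Ext¹(C, J⁺) = 0` for every injective `J`, where `⁺`
is the character module (`IsSES.flat_right`); for `n`-th syzygies this holds because
`id J⁺ ≤ pd J ≤ n`. The sum of the kernels is then a flat module `M` with an exact sequence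
`0 → M → P → M → 0`, `P` projective. By a theorem of Benson and Goodearl such an `M` is projective
(`projective_range_of_flat`); hence `K` is projective, and `pd F ≤ n`.

*If `pd I ≤ n` for every injective `I`, then `Ggldim R ≤ n`* (`isGorensteinProjective_of_isSyzygy`).
The same horseshoe argument shows that every `n`-th syzygy starts an exact sequence of projective
modules, infinite to the right, whose kernels are again `n`-th syzygies. Together with a projective
resolution this is a complete resolution once every projective module has injective dimension at
most `n` (`idLE_of_isProj`). Two facts give that. Modules of finite projective dimension have
projective dimension at most `2 n` (`pdLE_of_pdLE`), because their character modules have finite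
injective dimension, hence injective dimension at most `n`, so that their `n`-th syzygies are flat
and have projective dimension at most `n`. If `Q` is projective and `C` is its `2 n`-th cosyzygy,
then an embedding of `C` into an injective module has a cokernel of finite projective dimension,
which is therefore at most `2 n`; so the embedding splits and `C` is injective.

*The upper bound.* If `Gwdim R ≤ m`, then `Ext^{m+1}(M, I⁺) = 0` for all `M` and all injective `I`,
that is, `id I⁺ ≤ m`, and the `m`-th syzygies of `I` are flat. If moreover flat modules have
projective dimension at most `k`, then `pd I ≤ m + k`, so `Ggldim R ≤ m + k`. The case `m = 0` shows
that injective modules are flat when `Gwdim R = 0`. Finally `Gwdim R ≤ Ggldim R`: when `pd I ≤ n`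
for every injective `I`, the kernels of a complete projective resolution have vanishing `Ext` into
the modules `I⁺`, so the complex stays exact after tensoring with `I`.
-/

universe v

namespace GorensteinDim

/-! ### Locally split submodules of free modules -/

section LocallySplit

variable {R : Type*} [CommRing R]

/-- A submodule `B` of `P` is locally split if every finitely generated submodule of `B` is fixed
pointwise by an endomorphism of `P` with range in `B`. For `P` free this means that `P ⧸ B` is
flat. -/
def LocallySplit {P : Type*} [AddCommGroup P] [Module R P] (B : Submodule R P) : Prop :=
  ∀ N : Submodule R P, N.FG → N ≤ B →
    ∃ θ : P →ₗ[R] P, LinearMap.range θ ≤ B ∧ ∀ x ∈ N, θ x = x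

variable {X : Type*}

theorem exists_finset_supported {N : Submodule R (X →₀ R)} (hN : N.FG) :
    ∃ s : Finset X, N ≤ Finsupp.supported R R (s : Set X) := by
  classical
  obtain ⟨t, rfl⟩ := hN
  refine ⟨t.biUnion fun p => p.support, ?_⟩
  rw [Submodule.span_le]
  intro p hp x hx
  simp only [Finset.coe_biUnion, Set.mem_iUnion]
  exact ⟨p, hp, hx⟩

theorem supported_finset_fg (s : Finset X) : (Finsupp.supported R R (s : Set X)).FG := by
  classical
  rw [Finsupp.supported_eq_span_single]
  exact Submodule.fg_span (s.finite_toSet.image _)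

theorem exists_subset_of_le_map {P : Type*} [AddCommGroup P] [Module R P]
    (d : (X →₀ R) →ₗ[R] P) {Y : Set X} {N : Submodule R P} (hN : N.FG)
    (h : N ≤ (Finsupp.supported R R Y).map d) :
    ∃ T : Finset X, (T : Set X) ⊆ Y ∧ N ≤ (Finsupp.supported R R (T : Set X)).map d := by
  classical
  obtain ⟨t, rfl⟩ := hN
  have h' : ∀ p : P, p ∈ t → ∃ q ∈ Finsupp.supported R R Y, d q = p := fun p hp =>
    Submodule.mem_map.1 (h (Submodule.subset_span hp))
  choose! q hq hqd using h'
  refine ⟨t.biUnion fun p => (q p).support, ?_, ?_⟩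
  · intro x hx
    simp only [Finset.coe_biUnion, Set.mem_iUnion] at hx
    obtain ⟨p, hp, hx⟩ := hx
    exact hq p hp hx
  · rw [Submodule.span_le]
    intro p hp
    refine ⟨q p, ?_, hqd p hp⟩
    intro x hx
    simp only [Finset.coe_biUnion, Set.mem_iUnion]
    exact ⟨p, hp, hx⟩

/-- Extension by zero, as a linear map from the free module on a subset `Y` of `X` to the free
module on `X`. -/
noncomputable def extendZero (Y : Set X) : (Y →₀ R) →ₗ[R] (X →₀ R) :=
  Finsupp.lmapDomain R R Subtype.val

theorem extendZero_mem (Y : Set X) (p : Y →₀ R) :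
    extendZero Y p ∈ Finsupp.supported R R Y := by
  classical
  intro x hx
  have := Finsupp.mapDomain_support hx
  simp only [Finset.mem_image] at this
  obtain ⟨a, -, rfl⟩ := this
  exact a.2

theorem restrict_extendZero (Y : Set X) (p : Y →₀ R) :
    Finsupp.lsubtypeDomain (M := R) (R := R) Y (extendZero Y p) = p := by
  ext x
  exact Finsupp.mapDomain_apply Subtype.val_injective p x

theorem extendZero_restrict {Y : Set X} {p : X →₀ R} (hp : p ∈ Finsupp.supported R R Y) :
    extendZero Y (Finsupp.lsubtypeDomain (M := R) (R := R) Y p) = p := by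
  classical
  ext x
  by_cases hx : x ∈ Y
  · exact Finsupp.mapDomain_apply (f := Subtype.val) Subtype.val_injective _ ⟨x, hx⟩
  · have h1 : p x = 0 := by
      by_contra h
      exact hx (hp (Finsupp.mem_support_iff.2 h))
    have h2 : extendZero Y (Finsupp.lsubtypeDomain (M := R) (R := R) Y p) x = 0 := by
      by_contra h
      exact hx (extendZero_mem Y _ (Finsupp.mem_support_iff.2 h))
    rw [h1, h2]

theorem extendZero_range (Y : Set X) :
    LinearMap.range (extendZero (R := R) Y) = Finsupp.supported R R Y := by
  apply le_antisymm
  · rintro _ ⟨p, rfl⟩; exact extendZero_mem Y p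
  · intro p hp; exact ⟨_, extendZero_restrict hp⟩

theorem LocallySplit.exists_fg {B : Submodule R (X →₀ R)} (hB : LocallySplit B)
    {N : Submodule R (X →₀ R)} (hN : N.FG) (h : N ≤ B) :
    ∃ θ : (X →₀ R) →ₗ[R] (X →₀ R), (LinearMap.range θ).FG ∧ LinearMap.range θ ≤ B ∧
      ∀ x ∈ N, θ x = x := by
  obtain ⟨θ, h1, h2⟩ := hB N hN h
  obtain ⟨s, hs⟩ := exists_finset_supported hN
  refine ⟨θ ∘ₗ extendZero (s : Set X) ∘ₗ Finsupp.lsubtypeDomain (s : Set X), ?_, ?_, ?_⟩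
  · rw [← LinearMap.comp_assoc, LinearMap.range_comp_of_range_eq_top, LinearMap.range_comp,
      extendZero_range]
    · exact (supported_finset_fg s).map _
    · exact LinearMap.range_eq_top.2 fun p => ⟨_, restrict_extendZero _ p⟩
  · exact (LinearMap.range_comp_le_range _ _).trans h1
  · intro x hx
    simp [extendZero_restrict (hs hx), h2 x hx]

/-- The equational criterion: a finitely generated submodule of `B`, placed in a finitely generated
free module, is killed by a map to a free module through which the map to `P ⧸ B` factors. -/
theorem locallySplit_of_flat_quotient (B : Submodule R (X →₀ R))
    (hB : Module.Flat R ((X →₀ R) ⧸ B)) : LocallySplit B := by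
  intro N hN h
  obtain ⟨s, hs⟩ := exists_finset_supported hN
  set j := extendZero (R := R) (s : Set X)
  set p : (X →₀ R) →ₗ[R] ((s : Set X) →₀ R) := Finsupp.lsubtypeDomain (s : Set X)
  have hjp : ∀ x ∈ N, j (p x) = x := fun x hx => extendZero_restrict (hs hx)
  have : Module.Finite R (N.map p) := Module.Finite.of_fg (hN.map p)
  have hzero : (B.mkQ ∘ₗ j) ∘ₗ (N.map p).subtype = 0 := by
    ext ⟨_, x, hx, rfl⟩
    simp only [LinearMap.comp_apply, Submodule.subtype_apply, LinearMap.zero_apply]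
    rw [hjp x hx]
    simpa using h hx
  obtain ⟨k, a, y, hya, ha⟩ := Module.Flat.exists_factorization_of_comp_eq_zero_of_free
    (R := R) (M := (X →₀ R) ⧸ B) (K := ↥(N.map p)) (N := (s : Set X) →₀ R)
    (f := (N.map p).subtype) (x := B.mkQ ∘ₗ j) hzero
  obtain ⟨g, hg⟩ := Module.projective_lifting_property B.mkQ y B.mkQ_surjective
  refine ⟨(j - g ∘ₗ a) ∘ₗ p, ?_, ?_⟩
  · rintro _ ⟨x, rfl⟩
    rw [← Submodule.ker_mkQ B, LinearMap.mem_ker]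
    have h1 := LinearMap.congr_fun hya (p x)
    have h2 := LinearMap.congr_fun hg (a (p x))
    simp only [LinearMap.comp_apply, LinearMap.sub_apply, map_sub] at *
    rw [h1, h2, sub_self]
  · intro x hx
    have h1 : a (p x) = 0 := LinearMap.congr_fun ha ⟨p x, Submodule.mem_map_of_mem hx⟩
    simp [hjp x hx, h1]

/-- A countably generated locally split submodule is projective. The identity of `C` is the locally
finite sum of the maps `θ (N n) ∘ r n`, which are obtained by splitting off an increasing chain of
finitely generated submodules `N n`; it thus factors through a direct sum of copies of the free
module. -/
theorem LocallySplit.projective {G : Set (X →₀ R)} {C : Submodule R (X →₀ R)}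
    (hC : LocallySplit C) (hG : G.Countable) (hGC : Submodule.span R G = C) :
    Module.Projective R C := by
  classical
  obtain ⟨g, hg⟩ := (hG.insert 0).exists_eq_range (Set.insert_nonempty _ _)
  have hgC : ∀ n, g n ∈ C := by
    intro n
    have : g n ∈ insert 0 G := hg ▸ Set.mem_range_self n
    rcases this with h | h
    · rw [h]; exact zero_mem _
    · exact hGC ▸ Submodule.subset_span h
  choose! θ hθfg hθC hθ using fun (N : Submodule R (X →₀ R)) (h : N.FG ∧ N ≤ C) =>
    hC.exists_fg h.1 h.2
  let N : ℕ → Submodule R (X →₀ R) := fun n =>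
    Nat.rec ⊥ (fun n N => N ⊔ LinearMap.range (θ N) ⊔ Submodule.span R {g n}) n
  have hN1 : ∀ n, N (n + 1) = N n ⊔ LinearMap.range (θ (N n)) ⊔ Submodule.span R {g n} :=
    fun n => rfl
  have hN : ∀ n, (N n).FG ∧ N n ≤ C := by
    intro n
    induction n with
    | zero => exact ⟨Submodule.fg_bot, bot_le⟩
    | succ n ih =>
      rw [hN1]
      refine ⟨(ih.1.sup (hθfg _ ih)).sup (Submodule.fg_span_singleton _), ?_⟩
      exact sup_le (sup_le ih.2 (hθC _ ih))
        ((Submodule.span_singleton_le_iff_mem _ _).2 (hgC n))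
  have hmono : Monotone N := monotone_nat_of_le_succ fun n => by
    rw [hN1]; exact le_sup_left.trans le_sup_left
  have hex : ∀ b ∈ C, ∃ n, b ∈ N n := by
    have : C ≤ ⨆ n, N n := by
      rw [← hGC, Submodule.span_le]
      intro x hx
      have : x ∈ Set.range g := hg ▸ Set.mem_insert_of_mem _ hx
      obtain ⟨n, rfl⟩ := this
      refine (le_iSup N (n + 1)) ?_
      rw [hN1]
      exact (le_sup_right : Submodule.span R {g n} ≤ _) (Submodule.mem_span_singleton_self _)
    intro b hb
    exact (Submodule.mem_iSup_of_directed _ hmono.directed_le).1 (this hb)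
  -- the remainders after subtracting the successive approximations
  let r : ℕ → (X →₀ R) →ₗ[R] (X →₀ R) := fun n =>
    Nat.rec LinearMap.id (fun n r => r - θ (N n) ∘ₗ r) n
  have hr0 : r 0 = LinearMap.id := rfl
  have hr1 : ∀ n, r (n + 1) = r n - θ (N n) ∘ₗ r n := fun n => rfl
  have hrmem : ∀ b J, b ∈ N J → ∀ n ≤ J, r n b ∈ N J := by
    intro b J hb n
    induction n with
    | zero => intro _; simpa [hr0] using hb
    | succ n ih =>
      intro hn
      rw [hr1]
      refine sub_mem (ih (by omega)) (hmono hn ?_)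
      rw [hN1]
      exact (le_sup_right.trans le_sup_left : LinearMap.range (θ (N n)) ≤ _)
        (LinearMap.mem_range_self _ _)
  have hrzero : ∀ b J, b ∈ N J → ∀ n, J < n → r n b = 0 := by
    intro b J hb n hn
    induction n, hn using Nat.le_induction with
    | base =>
      rw [hr1]
      simp [hθ _ (hN J) _ (hrmem b J hb J le_rfl)]
    | succ n _ ih => rw [hr1]; simp [ih]
  have hsum : ∀ b n, b = (∑ i ∈ Finset.range n, θ (N i) (r i b)) + r n b := by
    intro b n
    induction n with
    | zero => simp [hr0]
    | succ n ih =>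
      rw [Finset.sum_range_succ, hr1]
      conv_lhs => rw [ih]
      simp
  have hfin : ∀ b : C, (Function.support fun n => r n (b : X →₀ R)).Finite := by
    intro b
    obtain ⟨J, hJ⟩ := hex b b.2
    refine (Set.finite_le_nat J).subset ?_
    intro n hn
    by_contra h
    exact hn (hrzero _ J hJ n (not_le.1 h))
  let σ : C →ₗ[R] (ℕ →₀ (X →₀ R)) :=
    { toFun := fun b => Finsupp.ofSupportFinite _ (hfin b)
      map_add' := fun b c => by
        apply Finsupp.ext; intro n
        simp [Finsupp.ofSupportFinite_coe]
      map_smul' := fun c b => by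
        apply Finsupp.ext; intro n
        simp [Finsupp.ofSupportFinite_coe] }
  have hσ : ∀ b n, σ b n = r n b := fun b n => rfl
  let τ : (ℕ →₀ (X →₀ R)) →ₗ[R] C := Finsupp.lsum R fun n =>
    (θ (N n)).codRestrict C fun x => hθC _ (hN n) (LinearMap.mem_range_self _ _)
  refine Module.Projective.of_split σ τ ?_
  ext1 b
  apply Subtype.ext
  obtain ⟨J, hJ⟩ := hex b b.2
  have h1 : τ (σ b) = ∑ n ∈ Finset.range (J + 1),
      (θ (N n)).codRestrict C (fun x => hθC _ (hN n) (LinearMap.mem_range_self _ _)) (σ b n) := by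
    refine Finsupp.sum_of_support_subset _ ?_ _ (by simp)
    intro n hn
    rw [Finsupp.mem_support_iff, hσ] at hn
    rw [Finset.mem_range]
    by_contra h
    exact hn (hrzero _ J hJ n (by omega))
  have h2 := hsum b (J + 1)
  rw [hrzero _ J hJ (J + 1) (by omega), add_zero] at h2
  simp only [LinearMap.comp_apply, LinearMap.id_apply]
  rw [h1, AddSubmonoidClass.coe_finsetSum]
  exact h2.symm

end LocallySplit

/-! ### Good subsets of a basis -/

section GoodSubset

variable {R : Type*} [CommRing R] {X : Type*}

/-- A countable set can be closed, inside a countable set, under an operation on finite subsets. -/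
theorem exists_countable_closed (Φ : Finset X → Finset X) {Z : Set X} (hZ : Z.Countable) :
    ∃ Z' : Set X, Z ⊆ Z' ∧ Z'.Countable ∧
        ∀ T : Finset X, (T : Set X) ⊆ Z' → (Φ T : Set X) ⊆ Z' := by
  classical
  let step : Set X → Set X := fun Y => Y ∪ ⋃ T ∈ {T : Finset X | (T : Set X) ⊆ Y}, (Φ T : Set X)
  have hstep : ∀ Y : Set X, Y.Countable → (step Y).Countable := by
    intro Y hY
    refine hY.union (Set.Countable.biUnion ?_ fun T _ => (Φ T).countable_toSet)
    have : Countable Y := hY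
    refine (Set.countable_range fun T : Finset Y => T.map (Function.Embedding.subtype _)).mono ?_
    intro T hT
    refine ⟨T.subtype (· ∈ Y), ?_⟩
    exact Finset.subtype_map_of_mem fun x hx => hT hx
  let S : ℕ → Set X := fun n => step^[n] Z
  have hS : ∀ n, S (n + 1) = step (S n) := fun n => Function.iterate_succ_apply' _ _ _
  have hmono : Monotone S := monotone_nat_of_le_succ fun n => by
    rw [hS]; exact Set.subset_union_left
  refine ⟨⋃ n, S n, Set.subset_iUnion S 0, Set.countable_iUnion fun n => ?_, fun T hT => ?_⟩
  · induction n with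
    | zero => exact hZ
    | succ n ih => rw [hS]; exact hstep _ ih
  · obtain ⟨n, hn⟩ := hmono.directed_le.exists_mem_subset_of_finset_subset_biUnion hT
    refine Set.Subset.trans ?_ (Set.subset_iUnion S (n + 1))
    rw [hS]
    exact Set.Subset.trans (Set.subset_biUnion_of_mem (u := fun T => (Φ T : Set X)) hn)
      Set.subset_union_right

/-- A subset `Y` of the basis `X` is good for an endomorphism `d` of the free module on `X` if `d`
maps the free module on `Y` to itself, the restricted map is exact (given `d ∘ d = 0`), and its
image is locally split in the free module on `X`. -/
structure IsGoodSubset (d : (X →₀ R) →ₗ[R] (X →₀ R)) (Y : Set X) : Prop where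
  map_le : (Finsupp.supported R R Y).map d ≤ Finsupp.supported R R Y
  ker_le : ∀ p ∈ Finsupp.supported R R Y, d p = 0 → p ∈ (Finsupp.supported R R Y).map d
  locallySplit : LocallySplit ((Finsupp.supported R R Y).map d)

theorem exists_mem_supported_of_directed {ι : Type*} [Nonempty ι] {Y : ι → Set X}
    (hY : Directed (· ⊆ ·) Y) {p : X →₀ R} (hp : p ∈ Finsupp.supported R R (⋃ i, Y i)) :
    ∃ i, p ∈ Finsupp.supported R R (Y i) :=
  hY.exists_mem_subset_of_finset_subset_biUnion hp

theorem locallySplit_map_iUnion (d : (X →₀ R) →ₗ[R] (X →₀ R)) {ι : Type*} [Nonempty ι]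
    {Y : ι → Set X} (hY : Directed (· ⊆ ·) Y)
    (h : ∀ i, LocallySplit ((Finsupp.supported R R (Y i)).map d)) :
    LocallySplit ((Finsupp.supported R R (⋃ i, Y i)).map d) := by
  intro N hN hle
  obtain ⟨T, hT, hNT⟩ := exists_subset_of_le_map d hN hle
  obtain ⟨i, hi⟩ := hY.exists_mem_subset_of_finset_subset_biUnion hT
  obtain ⟨θ, h1, h2⟩ := h i N hN (hNT.trans (Submodule.map_mono (Finsupp.supported_mono hi)))
  exact ⟨θ, h1.trans (Submodule.map_mono (Finsupp.supported_mono (Set.subset_iUnion _ _))), h2⟩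

theorem IsGoodSubset.iUnion {d : (X →₀ R) →ₗ[R] (X →₀ R)} {ι : Type*} [Nonempty ι]
    {Y : ι → Set X} (hY : Directed (· ⊆ ·) Y) (h : ∀ i, IsGoodSubset d (Y i)) :
    IsGoodSubset d (⋃ i, Y i) where
  map_le := by
    rintro _ ⟨p, hp, rfl⟩
    obtain ⟨i, hi⟩ := exists_mem_supported_of_directed hY hp
    exact Finsupp.supported_mono (Set.subset_iUnion _ _)
      ((h i).map_le (Submodule.mem_map_of_mem hi))
  ker_le := by
    intro p hp h0
    obtain ⟨i, hi⟩ := exists_mem_supported_of_directed hY hp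
    exact Submodule.map_mono (Finsupp.supported_mono (Set.subset_iUnion _ _))
      ((h i).ker_le p hi h0)
  locallySplit := locallySplit_map_iUnion d hY fun i => (h i).locallySplit

theorem isGoodSubset_empty (d : (X →₀ R) →ₗ[R] (X →₀ R)) : IsGoodSubset d ∅ := by
  constructor
  · simp
  · simp
  · intro N _ hle
    refine ⟨0, by simp, fun x hx => ?_⟩
    have := hle hx
    simp at this
    simp [this]

variable {d : (X →₀ R) →ₗ[R] (X →₀ R)}

theorem projective_map_supported_of_countable {Z : Set X} (hZ : Z.Countable)
    (h : LocallySplit ((Finsupp.supported R R Z).map d)) :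
    Module.Projective R ((Finsupp.supported R R Z).map d) := by
  refine h.projective ((hZ.image fun x => Finsupp.single x (1 : R)).image d) ?_
  rw [Finsupp.supported_eq_span_single, Submodule.map_span]

/-- The cycles supported on a countable set `Z` are countably generated: the image of the free
module on `Z` is projective, so the kernel is a direct summand of that free module. -/
theorem exists_countable_ker_le (hd : ∀ p, d p = 0 → p ∈ LinearMap.range d)
    {Z : Set X} (hZ : Z.Countable) (h : LocallySplit ((Finsupp.supported R R Z).map d)) :
    ∃ W : Set X, W.Countable ∧
      ∀ p ∈ Finsupp.supported R R Z, d p = 0 → p ∈ (Finsupp.supported R R W).map d := by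
  classical
  have hproj := projective_map_supported_of_countable hZ h
  set f : (Z →₀ R) →ₗ[R] ((Finsupp.supported R R Z).map d) :=
    (d ∘ₗ extendZero Z).codRestrict _ fun p => Submodule.mem_map_of_mem (extendZero_mem Z p)
  have hf : Function.Surjective f := by
    rintro ⟨_, p, hp, rfl⟩
    refine ⟨Finsupp.lsubtypeDomain (M := R) (R := R) Z p, Subtype.ext ?_⟩
    change d (extendZero Z _) = d p
    rw [extendZero_restrict hp]
  obtain ⟨s, hs⟩ := Module.projective_lifting_property f LinearMap.id hf
  set L : (Z →₀ R) →ₗ[R] (X →₀ R) := extendZero Z - extendZero Z ∘ₗ s ∘ₗ f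
  have hL : ∀ m, d (L m) = 0 := by
    intro m
    have h1 := congrArg Subtype.val (LinearMap.congr_fun hs (f m))
    change d (extendZero Z (s (f m))) = d (extendZero Z m) at h1
    simp [L, h1]
  choose q hq using fun z : Z => hd _ (hL (Finsupp.single z 1))
  have : Countable Z := hZ
  refine ⟨⋃ z, ((q z).support : Set X), Set.countable_iUnion fun z => (q z).support.countable_toSet,
    fun p hp h0 => ?_⟩
  have hLm : ∀ m, L m ∈ (Finsupp.supported R R (⋃ z, ((q z).support : Set X))).map d := by
    intro m
    induction m using Finsupp.induction_linear with
    | zero => rw [map_zero]; exact zero_mem _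
    | add a b ha hb => rw [map_add]; exact add_mem ha hb
    | single z r =>
      rw [← mul_one r, ← smul_eq_mul, ← Finsupp.smul_single, map_smul, ← hq z]
      exact Submodule.smul_mem _ _ (Submodule.mem_map_of_mem
        (Set.subset_iUnion (fun z => ((q z).support : Set X)) z))
  have hfp : f (Finsupp.lsubtypeDomain (M := R) (R := R) Z p) = 0 := by
    apply Subtype.ext
    change d (extendZero Z _) = 0
    rw [extendZero_restrict hp, h0]
  have := hLm (Finsupp.lsubtypeDomain (M := R) (R := R) Z p)
  simpa [L, hfp, extendZero_restrict hp] using this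

/-- Every element of the basis lies in a countable good subset. It is the union of a chain of
countable sets closed under finite choices: of supports of the images, and of local splittings; each
member of the chain provides preimages of the cycles of the preceding one. -/
theorem exists_countable_good (hd : ∀ p, d p = 0 ↔ p ∈ LinearMap.range d)
    (h : LocallySplit (LinearMap.range d)) (x : X) :
    ∃ Z : Set X, x ∈ Z ∧ IsGoodSubset d Z ∧
      Module.Projective R ((Finsupp.supported R R Z).map d) := by
  classical
  have hΦ : ∀ T : Finset X, ∃ W : Finset X,
      (Finsupp.supported R R (T : Set X)).map d ≤ Finsupp.supported R R (W : Set X) ∧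
      ∃ θ : (X →₀ R) →ₗ[R] (X →₀ R),
        LinearMap.range θ ≤ (Finsupp.supported R R (W : Set X)).map d ∧
        ∀ y ∈ (Finsupp.supported R R (T : Set X)).map d, θ y = y := by
    intro T
    have hfg := (supported_finset_fg (R := R) T).map d
    obtain ⟨W₁, hW₁⟩ := exists_finset_supported hfg
    obtain ⟨θ, h1, h2, h3⟩ := h.exists_fg hfg LinearMap.map_le_range
    rw [← Submodule.map_top d, ← Finsupp.supported_univ] at h2
    obtain ⟨W₂, -, hW₂⟩ := exists_subset_of_le_map d h1 h2
    refine ⟨W₁ ∪ W₂, hW₁.trans (Finsupp.supported_mono (by simp)), θ,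
      hW₂.trans (Submodule.map_mono (Finsupp.supported_mono (by simp))), h3⟩
  choose Φ hΦ₁ hΦ₂ using hΦ
  let Closed : Set X → Prop := fun Z => ∀ T : Finset X, (T : Set X) ⊆ Z → (Φ T : Set X) ⊆ Z
  have hmap : ∀ Z, Closed Z → (Finsupp.supported R R Z).map d ≤ Finsupp.supported R R Z := by
    rintro Z hZ _ ⟨p, hp, rfl⟩
    exact Finsupp.supported_mono (hZ p.support hp)
      (hΦ₁ p.support (Submodule.mem_map_of_mem (Finsupp.mem_supported_support R p)))
  have hsplit : ∀ Z, Closed Z → LocallySplit ((Finsupp.supported R R Z).map d) := by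
    intro Z hZ N hN hle
    obtain ⟨T, hT, hNT⟩ := exists_subset_of_le_map d hN hle
    obtain ⟨θ, h1, h2⟩ := hΦ₂ T
    exact ⟨θ, h1.trans (Submodule.map_mono (Finsupp.supported_mono (hZ T hT))),
      fun x hx => h2 x (hNT hx)⟩
  have hstep : ∀ Z : {Z : Set X // Z.Countable ∧ Closed Z},
    ∃ Z' : {Z : Set X // Z.Countable ∧ Closed Z},
      Z.1 ⊆ Z'.1 ∧ ∀ p ∈ Finsupp.supported R R Z.1, d p = 0 →
        p ∈ (Finsupp.supported R R Z'.1).map d := by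
    rintro ⟨Z, hZ, hZc⟩
    obtain ⟨W, hW, hWk⟩ := exists_countable_ker_le (fun p => (hd p).1) hZ (hsplit Z hZc)
    obtain ⟨Z', h1, h2, h3⟩ := exists_countable_closed Φ (hZ.union hW)
    exact ⟨⟨Z', h2, h3⟩, Set.subset_union_left.trans h1, fun p hp h0 =>
      Submodule.map_mono (Finsupp.supported_mono (Set.subset_union_right.trans h1)) (hWk p hp h0)⟩
  choose next hnext₁ hnext₂ using hstep
  obtain ⟨Z₀, hx, hZ₀, hZ₀c⟩ := exists_countable_closed Φ (Set.countable_singleton x)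
  let S : ℕ → {Z : Set X // Z.Countable ∧ Closed Z} := fun n => next^[n] ⟨Z₀, hZ₀, hZ₀c⟩
  have hS : ∀ n, S (n + 1) = next (S n) := fun n => Function.iterate_succ_apply' _ _ _
  have hmono : Monotone fun n => (S n).1 := monotone_nat_of_le_succ fun n => by
    rw [hS]; exact hnext₁ _
  have hdir : Directed (· ⊆ ·) fun n => (S n).1 := hmono.directed_le
  have hsp := locallySplit_map_iUnion d hdir fun n => hsplit _ (S n).2.2
  refine ⟨⋃ n, (S n).1, Set.mem_iUnion.2 ⟨0, hx rfl⟩, ⟨?_, ?_, hsp⟩,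
    projective_map_supported_of_countable (Set.countable_iUnion fun n => (S n).2.1) hsp⟩
  · rintro _ ⟨p, hp, rfl⟩
    obtain ⟨n, hn⟩ := exists_mem_supported_of_directed hdir hp
    exact Finsupp.supported_mono (Set.subset_iUnion (fun n => (S n).1) n)
      (hmap _ (S n).2.2 (Submodule.mem_map_of_mem hn))
  · intro p hp h0
    obtain ⟨n, hn⟩ := exists_mem_supported_of_directed hdir hp
    refine Submodule.map_mono (Finsupp.supported_mono
      (Set.subset_iUnion (fun n => (S n).1) (n + 1))) ?_
    simp only [hS]
    exact hnext₂ _ p hn h0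

end GoodSubset

/-! ### Flat modules in periodic exact sequences are projective -/

section Periodic

variable {R : Type*} [CommRing R] {X : Type*} {d : (X →₀ R) →ₗ[R] (X →₀ R)}

/-- The quotient map from the free module on `X` by the free module on `Y`, realized as the
restriction of coefficients to the complement of `Y`. -/
noncomputable abbrev restrictCompl (R : Type*) [CommRing R] {X : Type*} (Y : Set X) :
    (X →₀ R) →ₗ[R] ((Yᶜ : Set X) →₀ R) :=
  Finsupp.lsubtypeDomain Yᶜ

theorem restrictCompl_eq_zero {Y : Set X} {p : X →₀ R} :
    restrictCompl R Y p = 0 ↔ p ∈ Finsupp.supported R R Y := by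
  rw [Finsupp.mem_supported', Finsupp.ext_iff, Subtype.forall]
  rfl

theorem sub_extendZero_mem (Y : Set X) (p : X →₀ R) :
    p - extendZero Yᶜ (restrictCompl R Y p) ∈ Finsupp.supported R R Y := by
  rw [← restrictCompl_eq_zero, map_sub, restrict_extendZero, sub_self]

/-- The endomorphism induced by `d` on the quotient by the free module on `Y`, which is the free
module on the complement of `Y`; it is meaningful when `d` preserves the free module on `Y`. -/
noncomputable def quotientMap (d : (X →₀ R) →ₗ[R] (X →₀ R)) (Y : Set X) :
    ((Yᶜ : Set X) →₀ R) →ₗ[R] ((Yᶜ : Set X) →₀ R) :=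
  restrictCompl R Y ∘ₗ d ∘ₗ extendZero Yᶜ

theorem quotientMap_restrict {Y : Set X}
    (hY : (Finsupp.supported R R Y).map d ≤ Finsupp.supported R R Y) (p : X →₀ R) :
    quotientMap d Y (restrictCompl R Y p) = restrictCompl R Y (d p) := by
  have h := restrictCompl_eq_zero.2 (hY (Submodule.mem_map_of_mem (sub_extendZero_mem Y p)))
  rw [map_sub, map_sub, sub_eq_zero] at h
  exact h.symm

theorem restrictCompl_surjective (Y : Set X) : Function.Surjective (restrictCompl R Y) :=
  fun p => ⟨_, restrict_extendZero _ p⟩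

theorem quotientMap_exact (hd : ∀ p, d p = 0 ↔ p ∈ LinearMap.range d) {Y : Set X}
    (hY : IsGoodSubset d Y) (p : (Yᶜ : Set X) →₀ R) :
    quotientMap d Y p = 0 ↔ p ∈ LinearMap.range (quotientMap d Y) := by
  obtain ⟨p, rfl⟩ := restrictCompl_surjective Y p
  constructor
  · intro h
    rw [quotientMap_restrict hY.map_le, restrictCompl_eq_zero] at h
    obtain ⟨y, hy, hyd⟩ := hY.ker_le _ h ((hd _).2 ⟨p, rfl⟩)
    have : d (p - y) = 0 := by rw [map_sub, hyd, sub_self]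
    obtain ⟨q, hq⟩ := (hd _).1 this
    refine ⟨restrictCompl R Y q, ?_⟩
    rw [quotientMap_restrict hY.map_le, hq, map_sub, restrictCompl_eq_zero.2 hy, sub_zero]
  · rintro ⟨q, hq⟩
    obtain ⟨q, rfl⟩ := restrictCompl_surjective Y q
    rw [← hq, quotientMap_restrict hY.map_le, quotientMap_restrict hY.map_le, (hd _).2 ⟨q, rfl⟩,
      map_zero]

/-- Local splitness passes to the quotient by a good subset, where the quotient complex has the same
shape; this allows the construction of good subsets to be iterated. -/
theorem quotientMap_locallySplit (hd : ∀ p, d p = 0 ↔ p ∈ LinearMap.range d)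
    (h : LocallySplit (LinearMap.range d)) {Y : Set X} (hY : IsGoodSubset d Y) :
    LocallySplit (LinearMap.range (quotientMap d Y)) := by
  intro N hN hle
  set π := restrictCompl R Y
  set ι := extendZero (R := R) Yᶜ
  -- on representatives supported away from `Y`, the map `d` lands in the image under `d` of the
  -- free module on `Y`
  have hdN : (N.map ι).map d ≤ (Finsupp.supported R R Y).map d := by
    rintro _ ⟨_, ⟨b, hb, rfl⟩, rfl⟩
    have h0 : restrictCompl R Y (d (ι b)) = 0 := (quotientMap_exact hd hY b).2 (hle hb)
    exact hY.ker_le _ (restrictCompl_eq_zero.1 h0) ((hd _).2 ⟨_, rfl⟩)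
  obtain ⟨θ, hθ, hθN⟩ := hY.locallySplit _ ((hN.map ι).map d) hdN
  -- lift `(1 - θ) d` along `d`
  have hr : ∀ p, (d - θ ∘ₗ d) p ∈ LinearMap.range d := by
    intro p
    refine sub_mem ⟨p, rfl⟩ ?_
    exact LinearMap.map_le_range (hθ ⟨d p, rfl⟩)
  obtain ⟨lam, hlam⟩ := Module.projective_lifting_property d.rangeRestrict
    ((d - θ ∘ₗ d).codRestrict _ hr) d.surjective_rangeRestrict
  have hlam' : ∀ p, d (lam p) = d p - θ (d p) := fun p =>
    congrArg Subtype.val (LinearMap.congr_fun hlam p)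
  have hlamN : (N.map ι).map lam ≤ LinearMap.range d := by
    rintro _ ⟨b, hb, rfl⟩
    rw [← hd, hlam', hθN _ (Submodule.mem_map_of_mem hb), sub_self]
  obtain ⟨θ', hθ', hθN'⟩ := h _ ((hN.map ι).map lam) hlamN
  refine ⟨π ∘ₗ (LinearMap.id - lam + θ' ∘ₗ lam) ∘ₗ ι, ?_, ?_⟩
  · rintro _ ⟨p, rfl⟩
    rw [← quotientMap_exact hd hY]
    change quotientMap d Y (restrictCompl R Y _) = 0
    rw [quotientMap_restrict hY.map_le, restrictCompl_eq_zero]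
    have h1 : d (θ' (lam (ι p))) = 0 := (hd _).2 (hθ' ⟨_, rfl⟩)
    simp only [LinearMap.add_apply, LinearMap.sub_apply, LinearMap.id_apply, LinearMap.comp_apply,
      map_add, map_sub, hlam', h1]
    rw [add_zero, sub_sub_cancel]
    exact hY.map_le (hθ ⟨_, rfl⟩)
  · intro b hb
    have h1 := hθN' _ (Submodule.mem_map_of_mem (Submodule.mem_map_of_mem hb))
    simp only [LinearMap.add_apply, LinearMap.sub_apply, LinearMap.id_apply, LinearMap.comp_apply,
      h1, sub_add_cancel]
    exact restrict_extendZero _ b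

theorem mem_supported_union_iff {Y : Set X} {Z : Set (Yᶜ : Set X)} {p : X →₀ R} :
    p ∈ Finsupp.supported R R (Y ∪ Subtype.val '' Z) ↔
      restrictCompl R Y p ∈ Finsupp.supported R R Z := by
  rw [Finsupp.mem_supported', Finsupp.mem_supported', Subtype.forall]
  constructor
  · intro h x hx hxZ
    refine h x ?_
    rintro (h1 | ⟨y, hy, rfl⟩)
    · exact hx h1
    · exact hxZ hy
  · intro h x hx
    exact h x (fun h1 => hx (Or.inl h1)) fun h1 => hx (Or.inr ⟨_, h1, rfl⟩)

theorem restrict_mem_map_iff {Y : Set X}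
    (hY : (Finsupp.supported R R Y).map d ≤ Finsupp.supported R R Y)
    {Z : Set (Yᶜ : Set X)} {q : (Yᶜ : Set X) →₀ R} :
    q ∈ (Finsupp.supported R R Z).map (quotientMap d Y) ↔
      ∃ p ∈ Finsupp.supported R R (Y ∪ Subtype.val '' Z), restrictCompl R Y (d p) = q := by
  constructor
  · rintro ⟨p, hp, rfl⟩
    obtain ⟨p, rfl⟩ := restrictCompl_surjective Y p
    exact ⟨p, mem_supported_union_iff.2 hp, (quotientMap_restrict hY p).symm⟩
  · rintro ⟨p, hp, rfl⟩
    exact ⟨_, mem_supported_union_iff.1 hp, quotientMap_restrict hY p⟩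

theorem IsGoodSubset.union (hd : ∀ p, d p = 0 ↔ p ∈ LinearMap.range d) {Y : Set X}
    (hY : IsGoodSubset d Y) {Z : Set (Yᶜ : Set X)} (hZ : IsGoodSubset (quotientMap d Y) Z) :
    IsGoodSubset d (Y ∪ Subtype.val '' Z) where
  map_le := by
    rintro _ ⟨p, hp, rfl⟩
    rw [mem_supported_union_iff]
    exact hZ.map_le ((restrict_mem_map_iff hY.map_le).2 ⟨p, hp, rfl⟩)
  ker_le := by
    intro p hp h0
    have h1 := hZ.ker_le _ (mem_supported_union_iff.1 hp)
      (by rw [quotientMap_restrict hY.map_le, h0, map_zero])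
    obtain ⟨q, hq, hqp⟩ := (restrict_mem_map_iff hY.map_le).1 h1
    have h2 : p - d q ∈ Finsupp.supported R R Y := by
      rw [← restrictCompl_eq_zero, map_sub, hqp, sub_self]
    have h3 := hY.ker_le _ h2 (by rw [map_sub, h0, (hd _).2 ⟨q, rfl⟩, sub_self])
    rw [← sub_add_cancel p (d q)]
    exact add_mem (Submodule.map_mono (Finsupp.supported_mono Set.subset_union_left) h3)
      (Submodule.mem_map_of_mem hq)
  locallySplit := by
    intro N hN hle
    set π := restrictCompl R Y
    have hπ : ∀ b ∈ (Finsupp.supported R R (Y ∪ Subtype.val '' Z)).map d,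
        π b ∈ (Finsupp.supported R R Z).map (quotientMap d Y) := by
      rintro _ ⟨p, hp, rfl⟩
      exact (restrict_mem_map_iff hY.map_le).2 ⟨p, hp, rfl⟩
    obtain ⟨θ, hθ, hθN⟩ := hZ.locallySplit (N.map π) (hN.map π)
      (by rintro _ ⟨b, hb, rfl⟩; exact hπ b (hle hb))
    obtain ⟨θ₁, hθ₁⟩ := Module.projective_lifting_property
      (π.restrict hπ) ((θ ∘ₗ π).codRestrict _ fun p => hθ ⟨_, rfl⟩)
      (by
        rintro ⟨q, hq⟩
        obtain ⟨p, hp, hpq⟩ := (restrict_mem_map_iff hY.map_le).1 hq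
        exact ⟨⟨d p, Submodule.mem_map_of_mem hp⟩, Subtype.ext hpq⟩)
    have hθ₁' : ∀ p, π (θ₁ p : X →₀ R) = θ (π p) := fun p =>
      congrArg Subtype.val (LinearMap.congr_fun hθ₁ p)
    set η : (X →₀ R) →ₗ[R] (X →₀ R) := Submodule.subtype _ ∘ₗ θ₁
    have hη : ∀ p, η p ∈ (Finsupp.supported R R (Y ∪ Subtype.val '' Z)).map d := fun p => (θ₁ p).2
    have hN' : N.map (LinearMap.id - η) ≤ (Finsupp.supported R R Y).map d := by
      rintro _ ⟨b, hb, rfl⟩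
      refine hY.ker_le _ ?_ ?_
      · rw [← restrictCompl_eq_zero]
        change π (b - (θ₁ b : X →₀ R)) = 0
        rw [map_sub, hθ₁', hθN _ (Submodule.mem_map_of_mem hb), sub_self]
      · rw [hd]
        exact sub_mem (LinearMap.map_le_range (hle hb)) (LinearMap.map_le_range (hη b))
    obtain ⟨θ₂, hθ₂, hθN₂⟩ := hY.locallySplit _ (hN.map _) hN'
    refine ⟨η + θ₂ ∘ₗ (LinearMap.id - η), ?_, ?_⟩
    · rintro _ ⟨p, rfl⟩
      refine add_mem (hη p) ?_
      exact Submodule.map_mono (Finsupp.supported_mono Set.subset_union_left) (hθ₂ ⟨_, rfl⟩)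
    · intro x hx
      have h1 := hθN₂ _ (Submodule.mem_map_of_mem hx)
      simp only [LinearMap.add_apply, LinearMap.comp_apply, h1]
      simp

/-- A section of `d` over the image of the free module on a good subset `Y` extends to the union of
`Y` with a subset `Z` of the complement, if the image of the induced map on `Z` is projective. -/
theorem exists_section_extension {Y : Set X}
    (hY : IsGoodSubset d Y) (hd : ∀ p, d p = 0 ↔ p ∈ LinearMap.range d) {Z : Set (Yᶜ : Set X)}
    (hZ : Module.Projective R ((Finsupp.supported R R Z).map (quotientMap d Y)))
    (s : (Finsupp.supported R R Y).map d →ₗ[R] (X →₀ R)) (hs : ∀ a, d (s a) = a) :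
    ∃ s' : (Finsupp.supported R R (Y ∪ Subtype.val '' Z)).map d →ₗ[R] (X →₀ R),
      (∀ a, d (s' a) = a) ∧ ∀ (a : (Finsupp.supported R R Y).map d)
        (a' : (Finsupp.supported R R (Y ∪ Subtype.val '' Z)).map d),
        (a : X →₀ R) = a' → s a = s' a' := by
  set S := Finsupp.supported R R (Y ∪ Subtype.val '' Z)
  set π := restrictCompl R Y
  have hπ : ∀ b ∈ S.map d, π b ∈ (Finsupp.supported R R Z).map (quotientMap d Y) := by
    rintro _ ⟨p, hp, rfl⟩
    exact (restrict_mem_map_iff hY.map_le).2 ⟨p, hp, rfl⟩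
  set f : S →ₗ[R] ((Finsupp.supported R R Z).map (quotientMap d Y)) :=
    (π ∘ₗ d ∘ₗ S.subtype).codRestrict _ fun p => hπ _ (Submodule.mem_map_of_mem p.2)
  obtain ⟨c, hc⟩ := Module.projective_lifting_property f LinearMap.id (by
    rintro ⟨q, hq⟩
    obtain ⟨p, hp, hpq⟩ := (restrict_mem_map_iff hY.map_le).1 hq
    exact ⟨⟨p, hp⟩, Subtype.ext hpq⟩)
  have hc' : ∀ q, π (d (c q : X →₀ R)) = q := fun q =>
    congrArg Subtype.val (LinearMap.congr_fun hc q)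
  set c' : S.map d →ₗ[R] (X →₀ R) := S.subtype ∘ₗ c ∘ₗ π.restrict hπ
  have hc'' : ∀ a, π (d (c' a)) = π a := fun a => hc' _
  have hrem : ∀ a, ((S.map d).subtype - d ∘ₗ c') a ∈ (Finsupp.supported R R Y).map d := by
    intro a
    refine hY.ker_le _ ?_ ?_
    · rw [← restrictCompl_eq_zero]
      change π (a - d (c' a)) = 0
      rw [map_sub, hc'', sub_self]
    · rw [hd]
      exact sub_mem (LinearMap.map_le_range a.2) ⟨_, rfl⟩
  refine ⟨c' + s ∘ₗ ((S.map d).subtype - d ∘ₗ c').codRestrict _ hrem, ?_, ?_⟩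
  · intro a
    simp [hs]
  · intro a a' haa
    have h1 : π.restrict hπ a' = 0 := by
      apply Subtype.ext
      change π a' = 0
      rw [← haa]
      exact restrictCompl_eq_zero.2 (hY.map_le a.2)
    have h2 : c' a' = 0 := by simp [c', h1]
    have h3 : ((S.map d).subtype - d ∘ₗ c').codRestrict _ hrem a' = a := by
      apply Subtype.ext
      simp [h2, haa]
    rw [LinearMap.add_apply, h2, zero_add, LinearMap.comp_apply, h3]

/-- A maximal good subset carrying a section of `d` is the whole basis, because a countable good
subset of the complement could be added to it. -/
theorem projective_range_of_locallySplit (hd : ∀ p, d p = 0 ↔ p ∈ LinearMap.range d)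
    (h : LocallySplit (LinearMap.range d)) : Module.Projective R (LinearMap.range d) := by
  classical
  -- good subsets `Y` with a section of `d` over the image of the free module on `Y`
  let C : Set (Set X × ((X →₀ R) →ₗ.[R] (X →₀ R))) := {t | IsGoodSubset d t.1 ∧
    t.2.domain = (Finsupp.supported R R t.1).map d ∧ ∀ a, d (t.2 a) = a}
  obtain ⟨⟨Y, s⟩, ⟨hYgood, hdom, hsec⟩, hmax⟩ : ∃ m, Maximal (· ∈ C) m := by
    refine zorn_le₀ C fun c hcC hc => ?_
    rcases c.eq_empty_or_nonempty with rfl | hne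
    · refine ⟨(∅, ⟨⊥, 0⟩), ⟨isGoodSubset_empty d, by simp, ?_⟩, by simp⟩
      rintro ⟨a, ha⟩
      simp [(Submodule.mem_bot R).1 ha]
    have hdir : DirectedOn (· ≤ ·) c := hc.directedOn
    have hdir₂ : DirectedOn (· ≤ ·) (Prod.snd '' c) :=
      hdir.mono_comp (fun _ _ h => h.2)
    have := hne.to_subtype
    have hdir₁ : Directed (· ⊆ ·) fun t : c => t.1.1 := fun a b => by
      obtain ⟨e, he, h1, h2⟩ := hdir a a.2 b b.2
      exact ⟨⟨e, he⟩, h1.1, h2.1⟩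
    refine ⟨(⋃ t : c, t.1.1, LinearPMap.sSup _ hdir₂),
      ⟨IsGoodSubset.iUnion hdir₁ fun t => (hcC t.2).1, ?_, ?_⟩, fun z hz =>
        ⟨Set.subset_iUnion (fun t : c => t.1.1) ⟨z, hz⟩,
          LinearPMap.le_sSup hdir₂ ⟨z, hz, rfl⟩⟩⟩
    · ext x
      rw [LinearPMap.mem_domain_sSup_iff (hne.image _)]
      constructor
      · rintro ⟨_, ⟨t, ht, rfl⟩, hx⟩
        rw [(hcC ht).2.1] at hx
        exact Submodule.map_mono (Finsupp.supported_mono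
          (Set.subset_iUnion (fun t : c => t.1.1) ⟨t, ht⟩)) hx
      · rintro ⟨p, hp, rfl⟩
        obtain ⟨t, ht⟩ := exists_mem_supported_of_directed hdir₁ hp
        refine ⟨_, ⟨t, t.2, rfl⟩, ?_⟩
        rw [(hcC t.2).2.1]
        exact Submodule.mem_map_of_mem ht
    · intro a
      obtain ⟨_, ⟨t, ht, rfl⟩, hx⟩ :=
        (LinearPMap.mem_domain_sSup_iff (hne.image _) hdir₂).1 a.2
      rw [← (LinearPMap.le_sSup hdir₂ ⟨t, ht, rfl⟩).2 (x := ⟨a, hx⟩) (y := a) rfl]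
      exact (hcC ht).2.2 ⟨a, hx⟩
  replace hYgood : IsGoodSubset d Y := hYgood
  replace hdom : s.domain = (Finsupp.supported R R Y).map d := hdom
  replace hsec : ∀ a, d (s a) = a := hsec
  have hYuniv : Y = Set.univ := by
    by_contra hne
    obtain ⟨x, hx⟩ := (Set.ne_univ_iff_exists_notMem Y).1 hne
    obtain ⟨Z, hxZ, hZ, hZproj⟩ := exists_countable_good (quotientMap_exact hd hYgood)
      (quotientMap_locallySplit hd h hYgood) ⟨x, hx⟩
    obtain ⟨D, s⟩ := s
    obtain rfl : D = _ := hdom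
    obtain ⟨s', hs', hss'⟩ := exists_section_extension hYgood hd hZproj s hsec
    have hle : (Y, (⟨_, s⟩ : (X →₀ R) →ₗ.[R] (X →₀ R))) ≤ (Y ∪ Subtype.val '' Z, ⟨_, s'⟩) :=
      ⟨Set.subset_union_left, Submodule.map_mono (Finsupp.supported_mono Set.subset_union_left),
        fun a a' haa => hss' a a' haa⟩
    have := (hmax (y := (Y ∪ Subtype.val '' Z, ⟨_, s'⟩)) ⟨hYgood.union hd hZ, rfl, hs'⟩ hle).1
    exact hx (this (Or.inr ⟨_, hxZ, rfl⟩))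
  subst hYuniv
  rw [Finsupp.supported_univ, Submodule.map_top] at hdom
  obtain ⟨D, s⟩ := s
  obtain rfl : D = _ := hdom
  refine Module.Projective.of_split s d.rangeRestrict ?_
  ext1 a
  exact Subtype.ext (hsec a)

/-- **Benson–Goodearl**: if `0 → M → P → M → 0` is exact with `P` free and `M` flat, then `M` is
projective. Here `M` is the range of the composite `d : P → M → P`. -/
theorem projective_range_of_flat {P : Type*} [AddCommGroup P] [Module R P] [Module.Free R P]
    (d : P →ₗ[R] P) (hd : Function.Exact d d) (hflat : Module.Flat R (LinearMap.range d)) :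
    Module.Projective R (LinearMap.range d) := by
  let e := (Module.Free.chooseBasis R P).repr
  let d' := e.toLinearMap ∘ₗ d ∘ₗ e.symm.toLinearMap
  have hrange : LinearMap.range d' = (LinearMap.range d).map e.toLinearMap := by
    rw [LinearMap.range_comp, LinearMap.range_comp_of_range_eq_top]
    exact LinearEquiv.range _
  have hd' : ∀ p, d' p = 0 ↔ p ∈ LinearMap.range d' := by
    intro p
    rw [hrange]
    simp only [d', LinearMap.comp_apply, LinearEquiv.coe_coe, map_eq_zero_iff _ e.injective]
    rw [hd]
    constructor
    · rintro ⟨q, hq⟩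
      exact ⟨d q, ⟨q, rfl⟩, by simp [hq]⟩
    · rintro ⟨_, ⟨q, rfl⟩, rfl⟩
      exact ⟨q, by simp⟩
  have er : LinearMap.range d ≃ₗ[R] LinearMap.range d' :=
    e.submoduleMap _ ≪≫ₗ LinearEquiv.ofEq _ _ hrange.symm
  have hflat' : Module.Flat R (LinearMap.range d') := Module.Flat.of_linearEquiv er.symm
  have hk : LinearMap.ker d' = LinearMap.range d' := by ext p; exact hd' p
  have := projective_range_of_locallySplit hd' (locallySplit_of_flat_quotient _
    (Module.Flat.of_linearEquiv
      ((Submodule.quotEquivOfEq _ _ hk.symm) ≪≫ₗ d'.quotKerEquivRange)))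
  exact Module.Projective.of_equiv er.symm

end Periodic

/-! ### Vanishing of Ext along short exact sequences -/

section ExtCalculus

variable {R : Type u} [CommRing R]

/-- The sequence `0 → A → B → C → 0` of linear maps is exact. -/
structure IsSES {A B C : ModuleCat.{u} R} (f : A →ₗ[R] B) (g : B →ₗ[R] C) : Prop where
  inj : Function.Injective f
  exact : Function.Exact f g
  surj : Function.Surjective g

/-- The group `Ext^n(M, N)` vanishes. -/
abbrev ExtZero (n : ℕ) (M N : ModuleCat.{u} R) : Prop := Subsingleton (Abelian.Ext.{u} M N n)

variable {A B C M N : ModuleCat.{u} R} {f : A →ₗ[R] B} {g : B →ₗ[R] C}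

theorem IsSES.shortExact (h : IsSES f g) :
    (ModuleCat.shortComplexOfCompEqZero f g h.exact.linearMap_comp_eq_zero).ShortExact :=
  ModuleCat.shortComplex_shortExact _ h.exact h.inj h.surj

theorem extZero_iff {n : ℕ} : ExtZero n M N ↔ ∀ x : Abelian.Ext.{u} M N n, x = 0 :=
  ⟨fun _ _ => Subsingleton.elim _ _, fun h => ⟨fun x y => (h x).trans (h y).symm⟩⟩

theorem IsSES.extZero_right (h : IsSES f g) {n : ℕ} (hA : ExtZero n A N)
    (hB : ExtZero (n + 1) B N) :
    ExtZero (n + 1) C N := by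
  rw [extZero_iff] at *
  intro x
  obtain ⟨y, rfl⟩ := Abelian.Ext.contravariant_sequence_exact₃ h.shortExact N x
    (hB _) (add_comm 1 n)
  rw [hA y, Abelian.Ext.comp_zero]

theorem IsSES.extZero_mid (h : IsSES f g) {n : ℕ} (hA : ExtZero n A N) (hC : ExtZero n C N) :
    ExtZero n B N := by
  rw [extZero_iff] at *
  intro x
  obtain ⟨y, rfl⟩ := Abelian.Ext.contravariant_sequence_exact₂ h.shortExact N x (hA _)
  rw [hC y, Abelian.Ext.comp_zero]

theorem IsSES.extZero_left (h : IsSES f g) {n : ℕ} (hB : ExtZero n B N) (hC : ExtZero (n + 1) C N) :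
    ExtZero n A N := by
  rw [extZero_iff] at *
  intro x
  obtain ⟨y, rfl⟩ := Abelian.Ext.contravariant_sequence_exact₁ h.shortExact N x
    (add_comm 1 n) (hC _)
  rw [hB y, Abelian.Ext.comp_zero]

theorem IsSES.zeroExt_left (h : IsSES f g) {n : ℕ} (hC : ExtZero n M C) (hB : ExtZero (n + 1) M B) :
    ExtZero (n + 1) M A := by
  rw [extZero_iff] at *
  intro x
  obtain ⟨y, rfl⟩ := Abelian.Ext.covariant_sequence_exact₁ M h.shortExact x (hB _) rfl
  rw [hC y, Abelian.Ext.zero_comp]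

theorem IsSES.zeroExt_right (h : IsSES f g) {n : ℕ} (hB : ExtZero n M B)
    (hA : ExtZero (n + 1) M A) : ExtZero n M C := by
  rw [extZero_iff] at *
  intro x
  obtain ⟨y, rfl⟩ := Abelian.Ext.covariant_sequence_exact₃ M h.shortExact x rfl (hA _)
  rw [hB y, Abelian.Ext.zero_comp]

theorem extZero_of_projective (hM : Module.Projective R M) (n : ℕ) : ExtZero (n + 1) M N := by
  have := M.projective_of_categoryTheory_projective
  exact extZero_iff.2 fun x => x.eq_zero_of_projective

theorem extZero_of_injective (hN : Module.Injective R N) (n : ℕ) : ExtZero (n + 1) M N := by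
  have : Injective N := Module.injective_object_of_injective_module R N
  exact extZero_iff.2 fun x => x.eq_zero_of_injective

theorem projective_of_extZero (h : ∀ N, ExtZero 1 M N) : Module.Projective R M := by
  have : Projective M := projective_iff_subsingleton_ext_one.2 h
  exact M.projective_of_module_projective

theorem injective_of_extZero (h : ∀ M, ExtZero 1 M N) : Module.Injective R N := by
  have : Injective (ModuleCat.of R N) := injective_iff_subsingleton_ext_one.2 h
  exact Module.injective_module_of_injective_object R N

theorem IsSES.exists_extension (h : IsSES f g) (hC : ExtZero 1 C N) (φ : A →ₗ[R] N) :
    ∃ ψ : B →ₗ[R] N, ψ ∘ₗ f = φ := by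
  obtain ⟨x, hx⟩ := Abelian.Ext.contravariant_sequence_exact₁ h.shortExact N
    (Abelian.Ext.mk₀ (ModuleCat.ofHom φ)) (add_zero 1) (extZero_iff.1 hC _)
  obtain ⟨ψ, rfl⟩ := Abelian.Ext.homEquiv₀.symm.surjective x
  refine ⟨ψ.hom, ?_⟩
  have : ModuleCat.ofHom f ≫ ψ = ModuleCat.ofHom φ :=
    Abelian.Ext.homEquiv₀.symm.injective (by simpa using hx)
  exact congrArg ModuleCat.Hom.hom this

theorem IsSES.extZero_one_of_exists_extension (h : IsSES f g) (hB : ExtZero 1 B N)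
    (hext : ∀ φ : A →ₗ[R] N, ∃ ψ : B →ₗ[R] N, ψ ∘ₗ f = φ) : ExtZero 1 C N := by
  rw [extZero_iff] at *
  intro x
  obtain ⟨y, rfl⟩ := Abelian.Ext.contravariant_sequence_exact₃ h.shortExact N x (hB _) (add_zero 1)
  obtain ⟨φ, rfl⟩ := Abelian.Ext.homEquiv₀.symm.surjective y
  obtain ⟨ψ, hψ⟩ := hext φ.hom
  have : φ = ModuleCat.ofHom f ≫ ModuleCat.ofHom ψ := by
    ext a; exact (LinearMap.congr_fun hψ a).symm
  rw [this, Abelian.Ext.homEquiv₀_symm_apply, ← Abelian.Ext.mk₀_comp_mk₀]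
  exact h.shortExact.extClass_comp_assoc _

theorem IsSES.exists_lift (h : IsSES f g) (hA : ExtZero 1 M A) (φ : M →ₗ[R] C) :
    ∃ ψ : M →ₗ[R] B, g ∘ₗ ψ = φ := by
  obtain ⟨x, hx⟩ := Abelian.Ext.covariant_sequence_exact₃ M h.shortExact
    (Abelian.Ext.mk₀ (ModuleCat.ofHom φ)) (zero_add 1) (extZero_iff.1 hA _)
  obtain ⟨ψ, rfl⟩ := Abelian.Ext.homEquiv₀.symm.surjective x
  refine ⟨ψ.hom, ?_⟩
  have : ψ ≫ ModuleCat.ofHom g = ModuleCat.ofHom φ :=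
    Abelian.Ext.homEquiv₀.symm.injective (by simpa using hx)
  exact congrArg ModuleCat.Hom.hom this

theorem IsSES.extZero_one_of_exists_lift (h : IsSES f g) (hB : ExtZero 1 M B)
    (hlift : ∀ φ : M →ₗ[R] C, ∃ ψ : M →ₗ[R] B, g ∘ₗ ψ = φ) : ExtZero 1 M A := by
  rw [extZero_iff] at *
  intro x
  obtain ⟨y, rfl⟩ := Abelian.Ext.covariant_sequence_exact₁ M h.shortExact x (hB _) (zero_add 1)
  obtain ⟨φ, rfl⟩ := Abelian.Ext.homEquiv₀.symm.surjective y
  obtain ⟨ψ, hψ⟩ := hlift φ.hom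
  have : φ = ModuleCat.ofHom ψ ≫ ModuleCat.ofHom g := by
    ext a; exact (LinearMap.congr_fun hψ a).symm
  rw [this, Abelian.Ext.homEquiv₀_symm_apply, ← Abelian.Ext.mk₀_comp_mk₀,
    Abelian.Ext.comp_assoc_of_second_deg_zero, h.shortExact.comp_extClass, Abelian.Ext.comp_zero]

/-! sources of short exact sequences -/

theorem isSES_ker (g : B →ₗ[R] C) (hg : Function.Surjective g) :
    IsSES (A := ModuleCat.of R (LinearMap.ker g)) (LinearMap.ker g).subtype g where
  inj := Subtype.val_injective
  exact := g.exact_subtype_ker_map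
  surj := hg

theorem isSES_coker (f : A →ₗ[R] B) (hf : Function.Injective f) :
    IsSES (C := ModuleCat.of R (B ⧸ LinearMap.range f)) f (LinearMap.range f).mkQ where
  inj := hf
  exact := LinearMap.exact_map_mkQ_range f
  surj := Submodule.mkQ_surjective _

theorem exists_free_ses (M : ModuleCat.{u} R) :
    ∃ (K P : ModuleCat.{u} R) (f : K →ₗ[R] P) (g : P →ₗ[R] M), Module.Free R P ∧ IsSES f g :=
  ⟨_, ModuleCat.of R (M →₀ R), _, Finsupp.linearCombination R id,
    inferInstanceAs (Module.Free R (M →₀ R)),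
    isSES_ker (B := ModuleCat.of R (M →₀ R)) _ (Finsupp.linearCombination_id_surjective R M)⟩

theorem exists_injective_ses (M : ModuleCat.{u} R) :
    ∃ (I C : ModuleCat.{u} R) (f : M →ₗ[R] I) (g : I →ₗ[R] C),
        Module.Injective R I ∧ IsSES f g := by
  obtain ⟨⟨I, hI, f, hf⟩⟩ := EnoughInjectives.presentation M
  have : Injective (ModuleCat.of R I) := hI
  exact ⟨_, _, _, _, Module.injective_module_of_injective_object R _,
    isSES_coker f.hom ((ModuleCat.mono_iff_injective f).1 hf)⟩

theorem extZero_of_retract_left {M' : ModuleCat.{u} R} (i : M →ₗ[R] M') (r : M' →ₗ[R] M)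
    (h : r ∘ₗ i = LinearMap.id) {n : ℕ} (hM' : ExtZero n M' N) : ExtZero n M N := by
  rw [extZero_iff] at *
  intro x
  have h1 : ModuleCat.ofHom i ≫ ModuleCat.ofHom r = 𝟙 M := by
    ext a; exact LinearMap.congr_fun h a
  rw [← x.mk₀_id_comp, ← h1, ← Abelian.Ext.mk₀_comp_mk₀,
    Abelian.Ext.comp_assoc_of_second_deg_zero, hM' ((Abelian.Ext.mk₀ (ModuleCat.ofHom r)).comp x _),
    Abelian.Ext.comp_zero]

theorem pdLE_iff {n : ℕ} : HasProjectiveDimensionLE M n ↔ ∀ N, ExtZero (n + 1) M N :=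
  ⟨fun h N => h.subsingleton _ _ _ le_rfl N, hasProjectiveDimensionLT_of_enoughInjectives M _⟩

theorem idLE_iff {n : ℕ} : HasInjectiveDimensionLE N n ↔ ∀ M, ExtZero (n + 1) M N :=
  ⟨fun h M => h.subsingleton _ _ _ le_rfl M, hasInjectiveDimensionLT_of_enoughProjectives N _⟩

theorem pdLE_zero_iff : HasProjectiveDimensionLE M 0 ↔ Module.Projective R M :=
  pdLE_iff.trans ⟨projective_of_extZero, fun h _ => extZero_of_projective h 0⟩

theorem idLE_zero_iff : HasInjectiveDimensionLE N 0 ↔ Module.Injective R N :=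
  idLE_iff.trans ⟨injective_of_extZero, fun h _ => extZero_of_injective h 0⟩

theorem extZero_of_pdLE {n i : ℕ} (h : HasProjectiveDimensionLE M n) (hi : n < i) : ExtZero i M N :=
  h.subsingleton _ _ _ hi N

theorem extZero_of_idLE {n i : ℕ} (h : HasInjectiveDimensionLE N n) (hi : n < i) : ExtZero i M N :=
  h.subsingleton _ _ _ hi M

end ExtCalculus

/-! ### Character modules -/

section Character

variable {R : Type u} [CommRing R]

/-- The character module functor preserves and reflects exactness. -/
theorem character_exact_iff {A B C : Type*} [AddCommGroup A] [AddCommGroup B] [AddCommGroup C]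
    [Module R A] [Module R B] [Module R C] (f : A →ₗ[R] B) (g : B →ₗ[R] C) :
    Function.Exact (CharacterModule.dual g) (CharacterModule.dual f) ↔ Function.Exact f g := by
  constructor
  · intro h b
    constructor
    · intro hb
      by_contra hne
      have hne' : (LinearMap.range f).mkQ b ≠ 0 := by
        rw [Submodule.mkQ_apply, Ne, Submodule.Quotient.mk_eq_zero]
        exact hne
      obtain ⟨c, hc⟩ := CharacterModule.exists_character_apply_ne_zero_of_ne_zero hne'
      have h1 : CharacterModule.dual f (CharacterModule.dual (LinearMap.range f).mkQ c) = 0 := by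
        ext a
        change c ((LinearMap.range f).mkQ (f a)) = 0
        have : (LinearMap.range f).mkQ (f a) = 0 := by simp
        rw [this]; exact c.map_zero
      obtain ⟨c', hc'⟩ := (h _).1 h1
      apply hc
      change CharacterModule.dual (LinearMap.range f).mkQ c b = 0
      rw [← hc']
      change c' (g b) = 0
      rw [hb]; exact c'.map_zero
    · rintro ⟨a, rfl⟩
      refine CharacterModule.eq_zero_of_character_apply fun c => ?_
      have := (h _).2 ⟨c, rfl⟩
      exact DFunLike.congr_fun this a
  · intro h c
    constructor
    · intro hc
      have hker : ∀ b, g b = 0 → c b = 0 := by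
        intro b hb
        obtain ⟨a, rfl⟩ := (h b).1 hb
        exact DFunLike.congr_fun hc a
      let c₁ : CharacterModule (LinearMap.range g) :=
        g.rangeRestrict.toAddMonoidHom.liftOfSurjective g.surjective_rangeRestrict
          ⟨c, fun b hb => hker b (congrArg Subtype.val hb)⟩
      have hc₁ : ∀ b, c₁ (g.rangeRestrict b) = c b := fun b =>
        AddMonoidHom.liftOfRightInverse_comp_apply _ _ _ _ b
      obtain ⟨c₂, hc₂⟩ := CharacterModule.dual_surjective_of_injective
        (LinearMap.range g).subtype Subtype.val_injective c₁
      refine ⟨c₂, ?_⟩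
      ext b
      rw [← hc₁, ← hc₂]
      rfl
    · rintro ⟨c, rfl⟩
      ext a
      change c (g (f a)) = 0
      rw [h.apply_apply_eq_zero]; exact c.map_zero

/-- By the adjunction `Hom(A, N⁺) = (A ⊗ N)⁺`, a sequence stays exact under `N ⊗ -` if and only if
it stays exact under `Hom(-, N⁺)`. -/
theorem lcomp_character_exact_iff {A B C N : Type*} [AddCommGroup A] [AddCommGroup B]
    [AddCommGroup C] [AddCommGroup N] [Module R A] [Module R B] [Module R C] [Module R N]
    (f : A →ₗ[R] B) (g : B →ₗ[R] C) :
    Function.Exact (LinearMap.lcomp R (CharacterModule N) g)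
      (LinearMap.lcomp R (CharacterModule N) f) ↔
    Function.Exact (LinearMap.lTensor N f) (LinearMap.lTensor N g) := by
  have h1 : Function.Exact (LinearMap.lTensor N f) (LinearMap.lTensor N g) ↔
      Function.Exact (LinearMap.rTensor N f) (LinearMap.rTensor N g) := by
    refine Function.Exact.iff_of_ladder_linearEquiv (e₁ := TensorProduct.comm R A N)
      (e₂ := TensorProduct.comm R B N) (e₃ := TensorProduct.comm R C N) ?_ ?_
    · exact TensorProduct.ext' fun x y => by simp
    · exact TensorProduct.ext' fun x y => by simp
  rw [h1, ← character_exact_iff (LinearMap.rTensor N f)]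
  symm
  refine Function.Exact.iff_of_ladder_linearEquiv
    (e₁ := CharacterModule.homEquiv (R := R) (A := C) (B := N))
      (e₂ := CharacterModule.homEquiv (R := R) (A := B) (B := N))
      (e₃ := CharacterModule.homEquiv (R := R) (A := A) (B := N)) ?_ ?_
  · refine LinearMap.ext fun φ => CharacterModule.homEquiv.symm.injective ?_
    rfl
  · refine LinearMap.ext fun φ => CharacterModule.homEquiv.symm.injective ?_
    rfl

/-- The character module `Hom_ℤ(M, ℚ/ℤ)` as an object of the category of modules. -/
abbrev charDual (M : ModuleCat.{u} R) : ModuleCat.{u} R := ModuleCat.of R (CharacterModule M)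

variable {A B C M N : ModuleCat.{u} R} {f : A →ₗ[R] B} {g : B →ₗ[R] C}

theorem IsSES.charDual (h : IsSES f g) :
    IsSES (A := charDual C) (B := charDual B) (C := charDual A)
      (CharacterModule.dual g) (CharacterModule.dual f) where
  inj := CharacterModule.dual_injective_of_surjective _ h.surj
  exact := (character_exact_iff f g).2 h.exact
  surj := CharacterModule.dual_surjective_of_injective _ h.inj

/-- The symmetry `Hom(A, B⁺) = Hom(B, A⁺)`. -/
def charFlip {A B : Type*} [AddCommGroup A] [AddCommGroup B] [Module R A] [Module R B]
    (φ : A →ₗ[R] CharacterModule B) : B →ₗ[R] CharacterModule A where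
  toFun b :=
    { toFun := fun a => φ a b
      map_zero' := by rw [map_zero]; rfl
      map_add' := fun a a' => by rw [map_add]; rfl }
  map_add' b b' := by
    ext a
    exact (φ a).map_add b b'
  map_smul' r b := by
    ext a
    exact (DFunLike.congr_fun (φ.map_smul r a) b).symm

theorem flat_iff_injective_charDual : Module.Flat R M ↔ Module.Injective R (charDual M) :=
  Module.Flat.iff_characterModule_injective

theorem IsSES.flat_left (h : IsSES f g) (hB : Module.Flat R B) (hC : Module.Flat R C) :
    Module.Flat R A := by
  rw [flat_iff_injective_charDual, ← idLE_zero_iff] at *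
  have : HasInjectiveDimensionLT (GorensteinDim.charDual C) 1 := hC
  exact h.charDual.shortExact.hasInjectiveDimensionLT_X₃ 1 hB
    (hasInjectiveDimensionLT_of_ge _ 1 2 one_le_two)

/-- Character modules are cotorsion. -/
theorem extZero_charDual_of_flat (hM : Module.Flat R M) (n : ℕ) :
    ExtZero (n + 1) M (charDual N) := by
  induction n generalizing M with
  | zero =>
    obtain ⟨K, P, f, g, hP, h⟩ := exists_free_ses M
    refine h.extZero_one_of_exists_extension (extZero_of_projective inferInstance 0) fun φ => ?_
    obtain ⟨ψ, hψ⟩ := h.charDual.exists_lift (M := N)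
      (extZero_of_injective (flat_iff_injective_charDual.1 hM) 0) (charFlip φ)
    refine ⟨charFlip ψ, ?_⟩
    ext a b
    exact DFunLike.congr_fun (LinearMap.congr_fun hψ b) a
  | succ n ih =>
    obtain ⟨K, P, f, g, hP, h⟩ := exists_free_ses M
    have hK : Module.Flat R K := h.flat_left inferInstance hM
    exact h.extZero_right (ih hK) (extZero_of_projective inferInstance _)

/-- The cokernel `C` of a monomorphism of flat modules is flat if `Ext¹(C, I⁺) = 0` for every
injective `I`: a map `M → A⁺` extends to an injective module `I` containing `M`, and lifting the
extension along `B⁺ → A⁺` amounts to extending a map `A → I⁺` to `B`. Thus `C⁺` is injective. -/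
theorem IsSES.flat_right (h : IsSES f g) (hA : Module.Flat R A) (hB : Module.Flat R B)
    (hC : ∀ I : ModuleCat.{u} R, Module.Injective R I → ExtZero 1 C (GorensteinDim.charDual I)) :
    Module.Flat R C := by
  rw [flat_iff_injective_charDual] at *
  refine injective_of_extZero fun M => ?_
  refine h.charDual.extZero_one_of_exists_lift (extZero_of_injective hB 0) fun φ => ?_
  obtain ⟨I, C', i, p, hI, hM⟩ := exists_injective_ses M
  obtain ⟨φ', rfl⟩ := hM.exists_extension (extZero_of_injective hA 0) φ
  obtain ⟨ψ, hψ⟩ := h.exists_extension (hC I hI) (charFlip φ')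
  refine ⟨charFlip ψ ∘ₗ i, ?_⟩
  rw [← LinearMap.comp_assoc]
  congr 1
  ext x a
  exact DFunLike.congr_fun (LinearMap.congr_fun hψ a) x

/-- The injective dimension of the character module is at most the projective dimension. -/
theorem idLE_charDual {n : ℕ} (h : HasProjectiveDimensionLE M n) :
    HasInjectiveDimensionLE (charDual M) n := by
  induction n generalizing M with
  | zero =>
    have := pdLE_zero_iff.1 h
    exact idLE_zero_iff.2 (flat_iff_injective_charDual.1 inferInstance)
  | succ n ih =>
    obtain ⟨K, P, f, g, hP, hs⟩ := exists_free_ses M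
    have hP' : HasProjectiveDimensionLT P 1 := pdLE_zero_iff.2 inferInstance
    have hP'' : HasInjectiveDimensionLT (charDual P) 1 :=
      idLE_zero_iff.2 (flat_iff_injective_charDual.1 inferInstance)
    have hK : HasProjectiveDimensionLE K n :=
      hs.shortExact.hasProjectiveDimensionLT_X₁ (n + 1)
        (hasProjectiveDimensionLT_of_ge _ 1 _ (by omega)) h
    exact hs.charDual.shortExact.hasInjectiveDimensionLT_X₁ (n + 1) (ih hK)
      (hasInjectiveDimensionLT_of_ge _ 1 _ (by omega))

end Character

/-! ### Acyclic complexes of projective modules with flat cycles -/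

section PureAcyclic

/-- A projective module is a direct summand of a free module, with an explicit complement. -/
theorem exists_finsupp_equiv_prod (R : Type u) [CommRing R] (P : Type v) [AddCommGroup P]
    [Module R P] [Module.Projective R P] :
    ∃ (Q : Type (max u v)) (_ : AddCommGroup Q) (_ : Module R Q),
      Nonempty ((P →₀ R) ≃ₗ[R] P × Q) := by
  obtain ⟨s, hs⟩ := Module.projective_lifting_property (Finsupp.linearCombination R (id : P → P))
    LinearMap.id (Finsupp.linearCombination_id_surjective R P)
  let r : (P →₀ R) →ₗ[R] P := Finsupp.linearCombination R (id : P → P)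
  let Q := LinearMap.ker r
  have hrs : ∀ p, r (s p) = p := fun p => LinearMap.congr_fun hs p
  exact ⟨Q, inferInstance, inferInstance, ⟨LinearEquiv.ofBijective
    (r.prod ((LinearMap.id - s ∘ₗ r).codRestrict Q fun x => by simp [Q, hrs])) (by
      constructor
      · rw [injective_iff_map_eq_zero]
        intro x hx
        have h1 : r x = 0 := congrArg Prod.fst hx
        have h2 : x - s (r x) = 0 := congrArg Subtype.val (congrArg Prod.snd hx)
        rwa [h1, map_zero, sub_zero] at h2
      · rintro ⟨p, q, hq⟩
        have hq' : r q = 0 := hq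
        refine ⟨s p + q, Prod.ext (by simp [hrs, hq']) (Subtype.ext ?_)⟩
        simp [hrs, hq'])⟩⟩

/-- The Eilenberg swindle: a projective module becomes free after adding a free module. -/
theorem exists_free_prod_free (R : Type u) [CommRing R] (P : Type v) [AddCommGroup P] [Module R P]
    [Module.Projective R P] :
    ∃ (T : Type (max u v)) (_ : AddCommGroup T) (_ : Module R T),
      Module.Free R T ∧ Module.Free R (P × T) := by
  obtain ⟨Q, _, _, ⟨e⟩⟩ := exists_finsupp_equiv_prod R P
  let T : Type (max u v) := (ℕ →₀ P) × (ℕ →₀ Q)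
  have eT : (ℕ →₀ (P →₀ R)) ≃ₗ[R] T :=
    LinearEquiv.ofBijective (
        (Finsupp.mapRange.linearMap (LinearMap.fst R P Q ∘ₗ e.toLinearMap)).prod
      (Finsupp.mapRange.linearMap (LinearMap.snd R P Q ∘ₗ e.toLinearMap))) (by
      constructor
      · rw [injective_iff_map_eq_zero]
        intro x hx
        ext1 n
        apply e.injective
        rw [Finsupp.zero_apply, map_zero]
        exact Prod.ext (DFunLike.congr_fun (congrArg Prod.fst hx) n)
          (DFunLike.congr_fun (congrArg Prod.snd hx) n)
      · rintro ⟨a, b⟩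
        refine ⟨Finsupp.mapRange.linearMap (e.symm.toLinearMap ∘ₗ LinearMap.inl R P Q) a +
          Finsupp.mapRange.linearMap (e.symm.toLinearMap ∘ₗ LinearMap.inr R P Q) b, ?_⟩
        apply Prod.ext
        · ext1 n; simp
        · ext1 n; simp)
  have hT : Module.Free R T := Module.Free.of_equiv eT
  have eP : (ℕ →₀ P) ≃ₗ[R] P × (ℕ →₀ P) :=
    Finsupp.domLCongr Equiv.natSumPUnitEquivNat.{0}.symm ≪≫ₗ
      Finsupp.sumFinsuppLEquivProdFinsupp R ≪≫ₗ
      LinearEquiv.prodComm R _ _ ≪≫ₗ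
      LinearEquiv.prodCongr (Finsupp.uniqueLinearEquiv R P PUnit.unit) (LinearEquiv.refl R _)
  exact ⟨T, Prod.instAddCommGroup, Prod.instModule, hT, Module.Free.of_equiv
    (LinearEquiv.prodCongr eP (LinearEquiv.refl R (ℕ →₀ Q)) ≪≫ₗ LinearEquiv.prodAssoc R _ _ _)⟩

theorem flat_prod {R : Type*} [CommRing R] {A B : Type*} [AddCommGroup A] [AddCommGroup B]
    [Module R A] [Module R B] [Module.Flat R A] [Module.Flat R B] : Module.Flat R (A × B) := by
  rw [Module.Flat.iff_lTensor_injective']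
  intro I
  rw [injective_iff_map_eq_zero]
  intro x hx
  have h1 : LinearMap.rTensor I (LinearMap.fst R A B) x = 0 := by
    refine Module.Flat.lTensor_preserves_injective_linearMap (M := A) I.subtype
      Subtype.val_injective ?_
    rw [map_zero, ← LinearMap.comp_apply, LinearMap.lTensor_comp_rTensor,
      ← LinearMap.rTensor_comp_lTensor, LinearMap.comp_apply, hx, map_zero]
  have h2 : LinearMap.rTensor I (LinearMap.snd R A B) x = 0 := by
    refine Module.Flat.lTensor_preserves_injective_linearMap (M := B) I.subtype
      Subtype.val_injective ?_
    rw [map_zero, ← LinearMap.comp_apply, LinearMap.lTensor_comp_rTensor,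
      ← LinearMap.rTensor_comp_lTensor, LinearMap.comp_apply, hx, map_zero]
  have h3 : LinearMap.inl R A B ∘ₗ LinearMap.fst R A B +
    LinearMap.inr R A B ∘ₗ LinearMap.snd R A B =
      LinearMap.id := by ext <;> simp
  have h4 := LinearMap.congr_fun (congrArg (LinearMap.rTensor I) h3) x
  rw [LinearMap.rTensor_add, LinearMap.add_apply, LinearMap.rTensor_comp_apply,
    LinearMap.rTensor_comp_apply, h1, h2, map_zero, map_zero, add_zero, LinearMap.rTensor_id] at h4
  exact h4.symm

/-- The theorem of Benson and Goodearl for `P` projective: adding the sequence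
`0 → T → T × T → T → 0`, with `T` and `P × T` free, makes the middle term free. -/
theorem projective_range_of_flat_of_projective {R : Type*} [CommRing R] {P : Type*} [AddCommGroup P]
    [Module R P] [Module.Projective R P] (d : P →ₗ[R] P) (hd : Function.Exact d d)
    (hflat : Module.Flat R (LinearMap.range d)) : Module.Projective R (LinearMap.range d) := by
  obtain ⟨T, _, _, hT, hPT⟩ := exists_free_prod_free R P
  let d' : ((P × T) × T) →ₗ[R] ((P × T) × T) :=
    LinearMap.prod (LinearMap.prod (d ∘ₗ LinearMap.fst R P T ∘ₗ LinearMap.fst R _ T) 0)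
      (LinearMap.snd R P T ∘ₗ LinearMap.fst R _ T)
  have hd'a : ∀ x, d' x = ((d x.1.1, 0), x.1.2) := fun x => rfl
  have hd' : Function.Exact d' d' := by
    rintro ⟨⟨p, t⟩, t'⟩
    rw [hd'a]
    constructor
    · intro h
      simp only [Prod.mk_eq_zero] at h
      obtain ⟨q, rfl⟩ := (hd p).1 h.1.1
      exact ⟨((q, t'), 0), by simp [hd'a, h.2]⟩
    · rintro ⟨⟨⟨q, s⟩, s'⟩, h⟩
      simp only [hd'a, Prod.mk.injEq] at h
      rw [← h.1.1, ← h.1.2, hd.apply_apply_eq_zero]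
      rfl
  let e : LinearMap.range d' ≃ₗ[R] LinearMap.range d × T := LinearEquiv.ofBijective
    (((LinearMap.fst R P T ∘ₗ LinearMap.fst R _ T).restrict (p := LinearMap.range d')
      (q := LinearMap.range d) (by rintro _ ⟨x, rfl⟩; exact ⟨_, rfl⟩)).prod
      (LinearMap.snd R _ T ∘ₗ (LinearMap.range d').subtype)) (by
    constructor
    · rw [injective_iff_map_eq_zero]
      rintro ⟨_, x, rfl⟩ h
      have h1 : d x.1.1 = 0 := congrArg Subtype.val (congrArg Prod.fst h)
      have h2 : x.1.2 = 0 := congrArg Prod.snd h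
      apply Subtype.ext
      simp [hd'a, h1, h2]
    · rintro ⟨⟨_, p, rfl⟩, t⟩
      exact ⟨⟨_, ((p, t), 0), rfl⟩, rfl⟩)
  have : Module.Flat R (LinearMap.range d') :=
    have := flat_prod (R := R) (A := LinearMap.range d) (B := T)
    Module.Flat.of_linearEquiv e
  have : Module.Projective R (LinearMap.range d') := projective_range_of_flat d' hd' this
  have : Module.Projective R (LinearMap.range d × T) := Module.Projective.of_equiv e
  exact Module.Projective.of_split (LinearMap.inl R _ T) (LinearMap.fst R _ T) (by ext; rfl)

variable {R : Type u} [CommRing R]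

/-- There is a short exact sequence `0 → A → P → B → 0` with `P` in the class `C`. -/
def Link (C : ModuleCat.{u} R → Prop) (A B : ModuleCat.{u} R) : Prop :=
  ∃ (P : ModuleCat.{u} R) (f : A →ₗ[R] P) (g : P →ₗ[R] B), C P ∧ IsSES f g

open DirectSum in
/-- The sum of all the short exact sequences `0 → Z i → P i → Z (i + 1) → 0` is a sequence
`0 → M → P → M → 0`, to which the theorem of Benson and Goodearl applies. -/
theorem projective_of_pure_acyclic (Z : ℤ → ModuleCat.{u} R) (hZ : ∀ i, Module.Flat R (Z i))
    (h : ∀ i, Link (fun P => Module.Projective R P) (Z i) (Z (i + 1))) (k : ℤ) :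
    Module.Projective R (Z k) := by
  choose P f g hP hs using h
  let d : (⨁ i, P i) →ₗ[R] (⨁ i, P i) :=
    DirectSum.toModule R ℤ _ fun i => DirectSum.lof R ℤ (fun i => P i) (i + 1) ∘ₗ f (i + 1) ∘ₗ g i
  have hdlof : ∀ i (x : P i), d (DirectSum.lof R ℤ (fun i => P i) i x) =
      DirectSum.lof R ℤ (fun i => P i) (i + 1) (f (i + 1) (g i x)) := fun i x => by
    simp [d, DirectSum.toModule_lof]
  have hdapply : ∀ x i, d x (i + 1) = f (i + 1) (g i (x i)) := by
    intro x i
    induction x using DirectSum.induction_on with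
    | zero => simp
    | add x y hx hy => simp [hx, hy]
    | of j x =>
      rw [← DirectSum.lof_eq_of R, hdlof]
      by_cases hij : j = i
      · subst hij; rw [DirectSum.lof_apply, DirectSum.lof_apply]
      · rw [DirectSum.lof_eq_of, DirectSum.lof_eq_of, DirectSum.of_eq_of_ne, DirectSum.of_eq_of_ne]
        · simp
        · exact fun h => hij h.symm
        · exact fun h => hij (by omega)
  let φ : (⨁ i, Z i) →ₗ[R] (⨁ i, P i) := DFinsupp.mapRange.linearMap f
  have hφ : Function.Injective φ :=
    (DFinsupp.mapRange_injective _ fun i => map_zero _).2 fun i => (hs i).inj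
  have hφlof : ∀ i z, φ (DirectSum.lof R ℤ (fun i => Z i) i z) =
      DirectSum.lof R ℤ (fun i => P i) i (f i z) := fun i z =>
    DFinsupp.mapRange_single (hf := fun i => map_zero (f i))
  have hrange : LinearMap.range φ = LinearMap.range d := by
    apply le_antisymm
    · rintro _ ⟨z, rfl⟩
      induction z using DirectSum.induction_on with
      | zero => rw [map_zero]; exact zero_mem _
      | add x y hx hy => rw [map_add]; exact add_mem hx hy
      | of i z =>
        obtain ⟨i, rfl⟩ : ∃ j, i = j + 1 := ⟨i - 1, by omega⟩
        obtain ⟨p, rfl⟩ := (hs i).surj z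
        rw [← DirectSum.lof_eq_of R, hφlof]
        exact ⟨_, hdlof i p⟩
    · rintro _ ⟨x, rfl⟩
      induction x using DirectSum.induction_on with
      | zero => rw [map_zero]; exact zero_mem _
      | add x y hx hy => rw [map_add]; exact add_mem hx hy
      | of i x =>
        rw [← DirectSum.lof_eq_of R, hdlof]
        exact ⟨_, hφlof _ _⟩
  have hker : ∀ x, d x = 0 → x ∈ LinearMap.range φ := by
    intro x hx
    have hx' : ∀ i, ∃ z, f i z = x i := by
      intro i
      refine ((hs i).exact _).1 ((hs (i + 1)).inj ?_)
      rw [← hdapply, hx, map_zero]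
      rfl
    classical
    rw [← DirectSum.sum_support_of x]
    refine Submodule.sum_mem _ fun i _ => ?_
    obtain ⟨z, hz⟩ := hx' i
    rw [← hz]
    exact ⟨_, hφlof i z⟩
  have hexact : Function.Exact d d := by
    intro x
    constructor
    · intro hx
      exact (SetLike.ext_iff.1 hrange x).1 (hker x hx)
    · rintro ⟨y, rfl⟩
      induction y using DirectSum.induction_on with
      | zero => rw [map_zero, map_zero]
      | add a b ha hb => rw [map_add, map_add, ha, hb, add_zero]
      | of i x =>
        rw [← DirectSum.lof_eq_of R, hdlof, hdlof, (hs (i + 1)).exact.apply_apply_eq_zero,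
          map_zero, map_zero]
  let e : (⨁ i, Z i) ≃ₗ[R] LinearMap.range d :=
    LinearEquiv.ofInjective φ hφ ≪≫ₗ LinearEquiv.ofEq _ _ hrange
  have : Module.Projective R (LinearMap.range d) :=
    projective_range_of_flat_of_projective d hexact (Module.Flat.of_linearEquiv e.symm)
  have : Module.Projective R (⨁ i, Z i) := Module.Projective.of_equiv e.symm
  exact Module.Projective.directSum_iff.1 this k

end PureAcyclic

/-! ### Syzygies, and flat modules over rings whose injectives have bounded projective dimension -/

section Syzygy

variable {R : Type u} [CommRing R]

/-- A two-sided sequence whose consecutive terms are related by `r` exists through `a` if one can go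
forward within `p` and backward within the larger class `q`. -/
theorem exists_int_seq {α : Type*} (r : α → α → Prop) (p q : α → Prop)
    (hp : ∀ a, p a → q a) (hsucc : ∀ a, p a → ∃ b, p b ∧ r a b)
    (hpred : ∀ b, q b → ∃ a, q a ∧ r a b) {a : α} (ha : p a) :
    ∃ z : ℤ → α, z 0 = a ∧ (∀ i, q (z i)) ∧ ∀ i, r (z i) (z (i + 1)) := by
  choose! s hs hrs using hsucc
  choose! t ht hrt using hpred
  have hs' : ∀ n : ℕ, p (s^[n] a) := fun n => by
    induction n with
    | zero => exact ha
    | succ n ih => rw [Function.iterate_succ_apply']; exact hs _ ih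
  have ht' : ∀ n : ℕ, q (t^[n] a) := fun n => by
    induction n with
    | zero => exact hp _ ha
    | succ n ih => rw [Function.iterate_succ_apply']; exact ht _ ih
  let z : ℤ → α := fun i => match i with
    | Int.ofNat n => s^[n] a
    | Int.negSucc n => t^[n + 1] a
  refine ⟨z, rfl, ?_, ?_⟩
  · rintro (n | n)
    · exact hp _ (hs' n)
    · exact ht' (n + 1)
  · rintro (n | n | n)
    · change r (s^[n] a) (s^[n + 1] a)
      rw [Function.iterate_succ_apply']
      exact hrs _ (hs' n)
    · exact hrt _ (hp _ ha)
    · change r (t^[n + 1 + 1] a) (t^[n + 1] a)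
      rw [Function.iterate_succ_apply' t (n + 1)]
      exact hrt _ (ht' (n + 1))

/-- The class of projective modules. -/
abbrev IsProj (P : ModuleCat.{u} R) : Prop := Module.Projective R P

/-- There is a short exact sequence `0 → A → B → C → 0`. -/
def Ses (A B C : ModuleCat.{u} R) : Prop :=
  ∃ (f : A →ₗ[R] B) (g : B →ₗ[R] C), IsSES f g

variable {A B C M N K : ModuleCat.{u} R} {f : A →ₗ[R] B} {g : B →ₗ[R] C}

theorem IsSES.exists_desc (h : IsSES f g) (φ : B →ₗ[R] N) (hφ : φ ∘ₗ f = 0) :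
    ∃ ψ : C →ₗ[R] N, ψ ∘ₗ g = φ := by
  have hker : LinearMap.ker g ≤ LinearMap.ker φ := by
    intro b hb
    obtain ⟨a, rfl⟩ := (h.exact b).1 hb
    exact LinearMap.congr_fun hφ a
  refine ⟨(LinearMap.ker g).liftQ φ hker ∘ₗ
    (g.quotKerEquivOfSurjective h.surj).symm.toLinearMap, ?_⟩
  ext b
  have : (g.quotKerEquivOfSurjective h.surj).symm (g b) = (LinearMap.ker g).mkQ b := by
    rw [LinearEquiv.symm_apply_eq]; rfl
  simp [this]

theorem exists_link_isProj (M : ModuleCat.{u} R) : ∃ K, Link IsProj K M := by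
  obtain ⟨K, P, f, g, hP, h⟩ := exists_free_ses M
  exact ⟨K, P, f, g, inferInstanceAs (Module.Projective R P), h⟩

theorem link_of_equiv {Q : ModuleCat.{u} R → Prop} (e : M ≃ₗ[R] A)
    (h : Link Q A B) : Link Q M B := by
  obtain ⟨P, f, g, hP, h⟩ := h
  refine ⟨P, f ∘ₗ e.toLinearMap, g, hP, h.inj.comp e.injective, ?_, h.surj⟩
  intro p
  rw [h.exact p]
  constructor
  · rintro ⟨a, rfl⟩; exact ⟨e.symm a, by simp⟩
  · rintro ⟨a, rfl⟩; exact ⟨e a, rfl⟩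

/-- The horseshoe lemma, for a prescribed first syzygy of `A`. -/
theorem exists_horseshoe {A₁ : ModuleCat.{u} R} (hA : Link IsProj A₁ A) (h : Ses A B C) :
    ∃ B₁ C₁, Link IsProj B₁ B ∧ Link IsProj C₁ C ∧ Ses A₁ B₁ C₁ := by
  obtain ⟨P, i, p, hP, hA⟩ := hA
  obtain ⟨f, g, h⟩ := h
  obtain ⟨C₁, Q, j, q, hQ, hC⟩ := exists_free_ses C
  obtain ⟨l, hl⟩ := Module.projective_lifting_property g q h.surj
  have hl' : ∀ x, g (l x) = q x := fun x => LinearMap.congr_fun hl x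
  let π : (P × Q) →ₗ[R] B := (f ∘ₗ p).coprod l
  have hπ : Function.Surjective π := by
    intro b
    obtain ⟨x, hx⟩ := hC.surj (g b)
    have h1 : g (b - l x) = 0 := by rw [map_sub, hl', hx, sub_self]
    obtain ⟨a, ha⟩ := (h.exact _).1 h1
    obtain ⟨y, rfl⟩ := hA.surj a
    exact ⟨(y, x), by simp [π, ha]⟩
  have hgπ : ∀ y x, g (π (y, x)) = q x := fun y x => by
    simp [π, h.exact.apply_apply_eq_zero, hl']
  refine ⟨ModuleCat.of R (LinearMap.ker π), ModuleCat.of R (LinearMap.ker q),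
    ⟨ModuleCat.of R (P × Q), _, π, ?_, isSES_ker (B := ModuleCat.of R (P × Q)) π hπ⟩,
    ⟨Q, _, q, inferInstanceAs (Module.Projective R Q), isSES_ker q hC.surj⟩, ?_⟩
  · have : Module.Projective R P := hP
    exact inferInstanceAs (Module.Projective R (P × Q))
  · refine ⟨(LinearMap.inl R P Q ∘ₗ i).codRestrict (LinearMap.ker π) fun a => ?_,
      (LinearMap.snd R P Q).restrict ?_, ?_, ?_, ?_⟩
    · simp [π, hA.exact.apply_apply_eq_zero]
    · rintro ⟨y, x⟩ hx
      rw [LinearMap.mem_ker] at hx ⊢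
      rw [LinearMap.snd_apply, ← hgπ y x, hx, map_zero]
    · intro a a' haa
      exact hA.inj (congrArg (fun z => z.1.1) haa)
    · rintro ⟨⟨y, x⟩, hx⟩
      constructor
      · intro h0
        obtain rfl : x = 0 := congrArg Subtype.val h0
        have h1 : f (p y) = 0 := by simpa [π] using hx
        obtain ⟨a, rfl⟩ := (hA.exact y).1 (h.inj (h1.trans (map_zero f).symm))
        exact ⟨a, rfl⟩
      · rintro ⟨a, ha⟩
        apply Subtype.ext
        exact (congrArg (fun z => z.1.2) ha).symm
    · rintro ⟨x, hx⟩
      have h1 : g (l x) = 0 := (hl' x).trans hx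
      obtain ⟨a, ha⟩ := (h.exact _).1 h1
      obtain ⟨y, rfl⟩ := hA.surj a
      exact ⟨⟨(-y, x), by simp [π, ha]⟩, rfl⟩

/-- `IsSyzygy n M K` means that `K` is an `n`-th syzygy of `M`, with respect to some projective
resolution of `M`. -/
inductive IsSyzygy : ℕ → ModuleCat.{u} R → ModuleCat.{u} R → Prop
  | zero (M : ModuleCat.{u} R) : IsSyzygy 0 M M
  | succ {n : ℕ} {M M₁ K : ModuleCat.{u} R} (h : Link IsProj M₁ M) (hK : IsSyzygy n M₁ K) :
      IsSyzygy (n + 1) M K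

theorem exists_isSyzygy (n : ℕ) (M : ModuleCat.{u} R) : ∃ K, IsSyzygy n M K := by
  induction n generalizing M with
  | zero => exact ⟨M, .zero M⟩
  | succ n ih =>
    obtain ⟨M₁, h⟩ := exists_link_isProj M
    obtain ⟨K, hK⟩ := ih M₁
    exact ⟨K, .succ h hK⟩

theorem IsSyzygy.exists_horseshoe {n : ℕ} (hK : IsSyzygy n A K) (h : Ses A B C) :
    ∃ L K', IsSyzygy n B L ∧ IsSyzygy n C K' ∧ Ses K L K' := by
  induction hK generalizing B C with
  | zero M => exact ⟨B, C, .zero B, .zero C, h⟩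
  | succ hl _ ih =>
    obtain ⟨B₁, C₁, hB, hC, h₁⟩ := GorensteinDim.exists_horseshoe hl h
    obtain ⟨L, K', hL, hK', hs⟩ := ih h₁
    exact ⟨L, K', .succ hB hL, .succ hC hK', hs⟩

theorem IsSyzygy.extZero {n : ℕ} (hK : IsSyzygy n M K) {i : ℕ} (h : ExtZero (n + i + 1) M N) :
    ExtZero (i + 1) K N := by
  induction hK with
  | zero M => rwa [zero_add] at h
  | @succ n M M₁ K hl _ ih =>
    obtain ⟨P, f, g, hP, hs⟩ := hl
    refine ih (hs.extZero_left (extZero_of_projective hP _) ?_)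
    have : n + 1 + i + 1 = n + i + 1 + 1 := by omega
    rwa [this] at h

theorem IsSyzygy.projective {n : ℕ} (hK : IsSyzygy n M K) (h : HasProjectiveDimensionLE M n) :
    Module.Projective R K :=
  projective_of_extZero fun _ => hK.extZero (pdLE_iff.1 h _)

theorem IsSyzygy.pdLE {n k : ℕ} (hK : IsSyzygy n M K) (h : HasProjectiveDimensionLE K k) :
    HasProjectiveDimensionLE M (n + k) := by
  induction hK with
  | zero M => rwa [zero_add]
  | @succ n M M₁ K hl _ ih =>
    obtain ⟨P, f, g, hP, hs⟩ := hl
    have := hs.shortExact.hasProjectiveDimensionLT_X₃ (n + k + 1) (ih h)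
      (have : HasProjectiveDimensionLT P 1 := pdLE_zero_iff.2 hP
       hasProjectiveDimensionLT_of_ge _ 1 _ (by omega))
    have e : n + 1 + k + 1 = n + k + 1 + 1 := by omega
    rw [HasProjectiveDimensionLE, e]
    exact this

theorem link_flat_left (h : Link IsProj K M) (hM : Module.Flat R M) : Module.Flat R K := by
  obtain ⟨P, f, g, hP, hs⟩ := h
  have : Module.Projective R P := hP
  exact hs.flat_left inferInstance hM

theorem IsSyzygy.flat {n : ℕ} (hK : IsSyzygy n M K) (hM : Module.Flat R M) : Module.Flat R K := by
  induction hK with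
  | zero => exact hM
  | succ hl _ ih => exact ih (link_flat_left hl hM)

/-- If the injective modules have projective dimension at most `n`, then so do the flat modules. -/
theorem pdLE_of_flat {n : ℕ}
    (hinj : ∀ I : ModuleCat.{u} R, Module.Injective R I → HasProjectiveDimensionLE I n)
    (hM : Module.Flat R M) : HasProjectiveDimensionLE M n := by
  obtain ⟨K, hK⟩ := exists_isSyzygy n M
  obtain ⟨Z, hZ0, hZ, hl⟩ := exists_int_seq (Link IsProj)
    (fun K : ModuleCat.{u} R => Module.Flat R K ∧ ∃ M, IsSyzygy n M K)
    (fun K => Module.Flat R K) (fun _ h => h.1)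
    (by
      rintro K ⟨hKf, M, hK⟩
      -- the `n`-th syzygy of an injective module is projective
      obtain ⟨I, C, f, g, hI, hs⟩ := exists_injective_ses M
      obtain ⟨L, K', hL, hK', i, p, hs'⟩ := hK.exists_horseshoe ⟨f, g, hs⟩
      have hLp : Module.Projective R L := hL.projective (hinj I hI)
      refine ⟨K', ⟨hs'.flat_right hKf inferInstance fun J hJ => ?_, C, hK'⟩, L, i, p, hLp, hs'⟩
      exact hK'.extZero (idLE_iff.1 (idLE_charDual (hinj J hJ)) _))
    (fun K hKf => by
      obtain ⟨K', h⟩ := exists_link_isProj K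
      exact ⟨K', link_flat_left h hKf, h⟩)
    (show Module.Flat R K ∧ ∃ M, IsSyzygy n M K from ⟨hK.flat hM, M, hK⟩)
  have := projective_of_pure_acyclic Z hZ hl 0
  rw [hZ0] at this
  exact hK.pdLE (pdLE_zero_iff.2 this)

end Syzygy

/-! ### Complete resolutions -/

section CompleteResolution

variable {R : Type u} [CommRing R] {A B C M N K : ModuleCat.{u} R}

/-- `M` is the image of `P 0 → P 1` for an exact sequence of modules `P i` in the class `C` that
stays exact under `Hom(-, Q)` for all `Q` in the class `T`. If `C` and `T` consist of the projective
modules, then this says that `M` is Gorenstein projective. -/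
def IsComplete (C T : ModuleCat.{u} R → Prop) (M : ModuleCat.{u} R) : Prop :=
  ∃ (P : ℤ → ModuleCat.{u} R) (d : ∀ i, P i →ₗ[R] P (i + 1)),
    (∀ i, C (P i)) ∧
    (∀ i, Function.Exact (d i) (d (i + 1))) ∧
    (∀ Q : ModuleCat.{u} R, T Q →
      ∀ i, Function.Exact (LinearMap.lcomp R Q (d (i + 1))) (LinearMap.lcomp R Q (d i))) ∧
    Nonempty (M ≃ₗ[R] LinearMap.range (d 0))

/-- The class of flat modules. -/
abbrev IsFlat (P : ModuleCat.{u} R) : Prop := Module.Flat R P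

/-- The class of injective modules. -/
abbrev IsInj (P : ModuleCat.{u} R) : Prop := Module.Injective R P

/-- The class of the character modules of injective modules. -/
def IsDualOfInj (Q : ModuleCat.{u} R) : Prop := ∃ I, IsInj I ∧ Q = charDual I

theorem isGorensteinFlat_iff : IsGorensteinFlat M ↔ IsComplete IsFlat IsDualOfInj M := by
  refine exists_congr fun P => exists_congr fun d => and_congr Iff.rfl <| and_congr Iff.rfl <|
    and_congr ⟨?_, ?_⟩ Iff.rfl
  · rintro h _ ⟨I, hI, rfl⟩ i
    exact (lcomp_character_exact_iff _ _).2 (h I hI i)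
  · intro h I hI i
    exact (lcomp_character_exact_iff _ _).1 (h _ ⟨I, hI, rfl⟩ i)

/-- Dimension shifting in a sequence unbounded to the left: the vanishing of all the groups
`Ext¹(Z i, N)` implies that of the higher `Ext` groups. -/
theorem extZero_of_seq {Z : ℤ → ModuleCat.{u} R} {C : ModuleCat.{u} R → Prop}
    (hl : ∀ i, Link C (Z i) (Z (i + 1))) (hC : ∀ P, C P → ∀ n, ExtZero (n + 1) P N)
    (h1 : ∀ i, ExtZero 1 (Z i) N) (n : ℕ) (i : ℤ) : ExtZero (n + 1) (Z i) N := by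
  induction n generalizing i with
  | zero => exact h1 i
  | succ n ih =>
    obtain ⟨i, rfl⟩ : ∃ j, i = j + 1 := ⟨i - 1, by omega⟩
    obtain ⟨P, f, g, hP, hs⟩ := hl i
    exact hs.extZero_right (ih i) (hC P hP _)

/-- The kernels of a complete resolution have vanishing `Ext` into the modules of the class `T`. -/
theorem IsComplete.exists_seq {C T : ModuleCat.{u} R → Prop} (h : IsComplete C T M)
    (hCT : ∀ P Q, C P → T Q → ∀ n, ExtZero (n + 1) P Q) :
    ∃ Z : ℤ → ModuleCat.{u} R, Nonempty (M ≃ₗ[R] Z 0) ∧ (∀ i, Link C (Z i) (Z (i + 1))) ∧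
      ∀ Q, T Q → ∀ n i, ExtZero (n + 1) (Z i) Q := by
  obtain ⟨P, d, hP, hd, hT, ⟨e⟩⟩ := h
  let Z : ℤ → ModuleCat.{u} R := fun i => ModuleCat.of R (LinearMap.ker (d (i + 1)))
  let g : ∀ i, P (i + 1) →ₗ[R] Z (i + 1) := fun i =>
    (d (i + 1)).codRestrict (LinearMap.ker (d (i + 1 + 1))) fun x =>
      (hd (i + 1)).apply_apply_eq_zero x
  have hs : ∀ i, IsSES (A := Z i) (LinearMap.ker (d (i + 1))).subtype (g i) := fun i =>
    { inj := Subtype.val_injective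
      exact := by
        intro x
        constructor
        · intro hx
          exact ⟨⟨x, congrArg Subtype.val hx⟩, rfl⟩
        · rintro ⟨x, rfl⟩
          exact Subtype.ext x.2
      surj := by
        rintro ⟨x, hx⟩
        obtain ⟨y, rfl⟩ := (hd (i + 1) x).1 hx
        exact ⟨y, rfl⟩ }
  have hl : ∀ i, Link C (Z i) (Z (i + 1)) := fun i => ⟨P (i + 1), _, g i, hP _, hs i⟩
  refine ⟨Z, ⟨e ≪≫ₗ LinearEquiv.ofEq _ _ (LinearMap.exact_iff.1 (hd 0)).symm⟩, hl,
    fun Q hQ => extZero_of_seq hl (fun P hP => hCT P Q hP hQ) fun i => ?_⟩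
  obtain ⟨i, rfl⟩ : ∃ j, i = j + 1 + 1 := ⟨i - 2, by omega⟩
  refine (hs (i + 1)).extZero_one_of_exists_extension (hCT _ _ (hP _) hQ 0) fun φ => ?_
  have h0 : (φ ∘ₗ g i) ∘ₗ d i = 0 := by
    ext x
    have : g i (d i x) = 0 := Subtype.ext ((hd i).apply_apply_eq_zero x)
    simp [this]
  obtain ⟨ψ, hψ⟩ := (hT Q hQ i (φ ∘ₗ g i)).1 h0
  refine ⟨ψ, ?_⟩
  refine (LinearMap.cancel_right (hs i).surj).1 ?_
  exact hψ

theorem IsComplete.of_equiv {C T : ModuleCat.{u} R → Prop} (e : M ≃ₗ[R] N) (h : IsComplete C T N) :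
    IsComplete C T M := by
  obtain ⟨P, d, hP, hd, hT, ⟨e'⟩⟩ := h
  exact ⟨P, d, hP, hd, hT, ⟨e ≪≫ₗ e'⟩⟩

theorem isComplete_of_seq {C T : ModuleCat.{u} R → Prop} {Z : ℤ → ModuleCat.{u} R}
    (hl : ∀ i, Link C (Z i) (Z (i + 1))) (hT : ∀ Q, T Q → ∀ i, ExtZero 1 (Z i) Q) (k : ℤ) :
    IsComplete C T (Z k) := by
  have hl' : ∀ i, Link C (Z (i + (k - 1))) (Z (i + 1 + (k - 1))) := fun i => by
    have := hl (i + (k - 1))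
    rwa [show i + (k - 1) + 1 = i + 1 + (k - 1) by ring] at this
  choose P f g hP hs using hl'
  have hk : (0 : ℤ) + 1 + (k - 1) = k := by ring
  rw [← hk]
  refine ⟨P, fun i => f (i + 1) ∘ₗ g i, hP, ?_, ?_, ⟨?_⟩⟩
  · intro i x
    constructor
    · intro hx
      have h1 : g (i + 1) x = 0 := (hs (i + 1 + 1)).inj (hx.trans (map_zero _).symm)
      obtain ⟨z, rfl⟩ := ((hs (i + 1)).exact x).1 h1
      obtain ⟨y, rfl⟩ := (hs i).surj z
      exact ⟨y, rfl⟩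
    · rintro ⟨y, rfl⟩
      simp [(hs (i + 1)).exact.apply_apply_eq_zero]
  · intro Q hQ i φ
    constructor
    · intro h0
      have h1 : φ ∘ₗ f (i + 1) = 0 := (LinearMap.cancel_right (hs i).surj).1 h0
      obtain ⟨χ, rfl⟩ := (hs (i + 1)).exists_desc φ h1
      obtain ⟨ψ, rfl⟩ := (hs (i + 1 + 1)).exists_extension (hT Q hQ _) χ
      exact ⟨ψ, rfl⟩
    · rintro ⟨ψ, rfl⟩
      ext x
      simp [(hs (i + 1)).exact.apply_apply_eq_zero]
  · exact LinearEquiv.ofInjective (f (0 + 1)) (hs (0 + 1)).inj ≪≫ₗ LinearEquiv.ofEq _ _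
      (LinearMap.range_comp_of_range_eq_top _ (LinearMap.range_eq_top.2 (hs 0).surj)).symm

/-- A coinduction principle: a class of modules consists of Gorenstein projective modules if its
members have vanishing `Ext` into the projective modules, and each of them embeds into a projective
module with cokernel again in the class. -/
theorem isGorensteinProjective_of_coinduction (p : ModuleCat.{u} R → Prop)
    (hext : ∀ M, p M → ∀ Q, IsProj Q → ∀ n, ExtZero (n + 1) M Q)
    (hstep : ∀ M, p M → ∃ M', p M' ∧ Link IsProj M M') (hM : p M) :
    IsGorensteinProjective M := by
  obtain ⟨Z, hZ0, hZ, hl⟩ := exists_int_seq (Link IsProj) p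
    (fun M => ∀ Q, IsProj Q → ∀ n, ExtZero (n + 1) M Q) hext hstep
    (fun M hM => by
      obtain ⟨K, P, f, g, hP, hs⟩ := exists_link_isProj M
      exact ⟨K, fun Q hQ n => hs.extZero_left (extZero_of_projective hP n) (hM Q hQ (n + 1)),
        P, f, g, hP, hs⟩) hM
  rw [← hZ0]
  exact isComplete_of_seq hl (fun Q hQ i => hZ i Q hQ 0) 0

theorem IsGorensteinProjective.exists_seq (h : IsGorensteinProjective M) :
    ∃ Z : ℤ → ModuleCat.{u} R, Nonempty (M ≃ₗ[R] Z 0) ∧ (∀ i, Link IsProj (Z i) (Z (i + 1))) ∧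
      ∀ Q, IsProj Q → ∀ n i, ExtZero (n + 1) (Z i) Q :=
  IsComplete.exists_seq h fun _ _ hP _ n => extZero_of_projective hP n

theorem extZero_of_equiv (e : M ≃ₗ[R] A) {n : ℕ} (h : ExtZero n A N) : ExtZero n M N :=
  extZero_of_retract_left e.toLinearMap e.symm.toLinearMap (by ext; simp) h

theorem IsGorensteinProjective.extZero (h : IsGorensteinProjective M) (hN : IsProj N) (n : ℕ) :
    ExtZero (n + 1) M N := by
  obtain ⟨Z, ⟨e⟩, -, hZ⟩ := h.exists_seq
  exact extZero_of_equiv e (hZ N hN n 0)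

theorem IsGorensteinProjective.exists_link (h : IsGorensteinProjective M) :
    ∃ M', IsGorensteinProjective M' ∧ Link IsProj M M' := by
  obtain ⟨Z, ⟨e⟩, hl, hZ⟩ := h.exists_seq
  exact ⟨Z (0 + 1), isComplete_of_seq hl (fun Q hQ i => hZ Q hQ 0 i) _, link_of_equiv e (hl 0)⟩

theorem isGorensteinProjective_of_isProj (h : IsProj M) : IsGorensteinProjective M := by
  refine isGorensteinProjective_of_coinduction IsProj
    (fun M hM Q _ n => extZero_of_projective hM n) (fun M hM => ?_) h
  refine ⟨ModuleCat.of R PUnit.{u + 1}, inferInstanceAs (Module.Projective R PUnit.{u + 1}),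
    M, LinearMap.id, 0, hM,
    Function.injective_id, ?_, fun x => ⟨0, rfl⟩⟩
  intro x
  exact ⟨fun _ => ⟨x, rfl⟩, fun _ => rfl⟩

theorem IsGorensteinFlat.extZero (h : IsGorensteinFlat M) (hN : IsInj N) (n : ℕ) :
    ExtZero (n + 1) M (charDual N) := by
  obtain ⟨Z, ⟨e⟩, -, hZ⟩ := (isGorensteinFlat_iff.1 h).exists_seq (by
    rintro P _ hP ⟨I, hI, rfl⟩ n
    exact extZero_charDual_of_flat hP n)
  exact extZero_of_equiv e (hZ _ ⟨N, hN, rfl⟩ n 0)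

/-- The kernels `Z i` of a complete projective resolution have vanishing `Ext` into `I⁺`, as
`Ext^j(Z i, I⁺) = Ext^{j+n}(Z (i + n), I⁺)` and `I⁺` has injective dimension at most `n`. -/
theorem IsGorensteinProjective.isGorensteinFlat {n : ℕ}
    (hinj : ∀ I : ModuleCat.{u} R, IsInj I → HasProjectiveDimensionLE I n)
    (h : IsGorensteinProjective M) : IsGorensteinFlat M := by
  obtain ⟨Z, ⟨e⟩, hl, -⟩ := h.exists_seq
  rw [isGorensteinFlat_iff]
  refine IsComplete.of_equiv e (isComplete_of_seq (fun i => ?_) ?_ 0)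
  · obtain ⟨P, f, g, hP, hs⟩ := hl i
    have : Module.Projective R P := hP
    exact ⟨P, f, g, inferInstanceAs (Module.Flat R P), hs⟩
  · rintro _ ⟨I, hI, rfl⟩ i
    have key : ∀ (k : ℕ) (i : ℤ) (j : ℕ), n ≤ j + k → ExtZero (j + 1) (Z i) (charDual I) := by
      intro k
      induction k with
      | zero => exact fun i j hj => extZero_of_idLE (idLE_charDual (hinj I hI)) (by omega)
      | succ k ih =>
        intro i j hj
        obtain ⟨P, f, g, hP, hs⟩ := hl i
        exact hs.extZero_left (extZero_of_projective hP _) (ih _ (j + 1) (by omega))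
    exact key n i 0 (by omega)

/-- Over an IF-ring, an injective coresolution of `M` spliced with a free resolution is a complete
flat resolution. -/
theorem isGorensteinFlat_of_isIF (hIF : IsIF R) (M : ModuleCat.{u} R) : IsGorensteinFlat M := by
  obtain ⟨Z, hZ0, -, hl⟩ := exists_int_seq (Link (R := R) IsFlat) (fun _ => True) (fun _ => True)
    (fun _ h => h)
    (fun M _ => by
      obtain ⟨I, C, f, g, hI, hs⟩ := exists_injective_ses M
      exact ⟨C, trivial, I, f, g, hIF I hI, hs⟩)
    (fun M _ => by
      obtain ⟨K, P, f, g, hP, hs⟩ := exists_free_ses M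
      exact ⟨K, trivial, P, f, g, inferInstanceAs (Module.Flat R P), hs⟩) (a := M) trivial
  rw [isGorensteinFlat_iff, ← hZ0]
  refine isComplete_of_seq hl ?_ 0
  rintro _ ⟨I, hI, rfl⟩ i
  exact extZero_of_injective (flat_iff_injective_charDual.1 (hIF I hI)) 0

/-- Gorenstein projective modules are closed under extensions. -/
theorem isGorensteinProjective_of_ses (h : Ses A B C) (hA : IsGorensteinProjective A)
    (hC : IsGorensteinProjective C) : IsGorensteinProjective B := by
  refine isGorensteinProjective_of_coinduction
    (fun B => ∃ A C, Ses A B C ∧ IsGorensteinProjective A ∧ IsGorensteinProjective C)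
    ?_ ?_ ⟨A, C, h, hA, hC⟩
  · rintro B ⟨A, C, ⟨f, g, hs⟩, hA, hC⟩ Q hQ n
    exact hs.extZero_mid (hA.extZero hQ n) (hC.extZero hQ n)
  · rintro B ⟨A, C, ⟨f, g, hs⟩, hA, hC⟩
    obtain ⟨A', hA', P, iA, pA, hP, hsA⟩ := hA.exists_link
    obtain ⟨C', hC', Q, iC, pC, hQ, hsC⟩ := hC.exists_link
    obtain ⟨ψ, hψ⟩ := hs.exists_extension (hC.extZero hP 0) iA
    have hψ' : ∀ a, ψ (f a) = iA a := fun a => LinearMap.congr_fun hψ a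
    let e : B →ₗ[R] P × Q := ψ.prod (iC ∘ₗ g)
    have he : ∀ b, e b = (ψ b, iC (g b)) := fun b => rfl
    have heinj : Function.Injective e := by
      rw [injective_iff_map_eq_zero]
      intro b hb
      have h1 : ψ b = 0 := congrArg Prod.fst hb
      have h2 : iC (g b) = 0 := congrArg Prod.snd hb
      obtain ⟨a, rfl⟩ := (hs.exact b).1 (hsC.inj (h2.trans (map_zero _).symm))
      rw [hψ'] at h1
      rw [hsA.inj (h1.trans (map_zero _).symm), map_zero]
    have : Module.Projective R P := hP
    have : Module.Projective R Q := hQ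
    let B' := (P × Q) ⧸ LinearMap.range e
    let q : P × Q →ₗ[R] B' := (LinearMap.range e).mkQ
    have hq : ∀ x, q x = 0 ↔ ∃ b, e b = x := fun x => by
      rw [Submodule.mkQ_apply, Submodule.Quotient.mk_eq_zero, LinearMap.mem_range]
    obtain ⟨j, hj⟩ := hsA.exists_desc (N := ModuleCat.of R B') (q ∘ₗ LinearMap.inl R P Q) (by
      ext a
      refine (hq _).2 ⟨f a, ?_⟩
      rw [he, hψ', hs.exact.apply_apply_eq_zero, map_zero]
      rfl)
    have hj' : ∀ x, j (pA x) = q (x, 0) := fun x => LinearMap.congr_fun hj x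
    let r : B' →ₗ[R] C' := (LinearMap.range e).liftQ (pC ∘ₗ LinearMap.snd R P Q) (by
      rintro _ ⟨b, rfl⟩
      simp [he, hsC.exact.apply_apply_eq_zero])
    have hr : ∀ x y, r (q (x, y)) = pC y := fun x y => rfl
    refine ⟨ModuleCat.of R B', ⟨A', C', ⟨j, r, ?_, ?_, ?_⟩, hA', hC'⟩, ModuleCat.of R (P × Q), e, q,
      inferInstanceAs (Module.Projective R (P × Q)),
        isSES_coker (B := ModuleCat.of R (P × Q)) e heinj⟩
    · rw [injective_iff_map_eq_zero]
      intro a' ha'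
      obtain ⟨x, rfl⟩ := hsA.surj a'
      rw [hj'] at ha'
      obtain ⟨b, hb⟩ := (hq _).1 ha'
      rw [he, Prod.mk.injEq] at hb
      obtain ⟨a, rfl⟩ := (hs.exact b).1 (hsC.inj (hb.2.trans (map_zero _).symm))
      rw [← hb.1, hψ', hsA.exact.apply_apply_eq_zero]
    · intro b'
      obtain ⟨⟨x, y⟩, rfl⟩ := Submodule.mkQ_surjective _ b'
      change r (q (x, y)) = 0 ↔ q (x, y) ∈ _
      rw [hr]
      constructor
      · intro hy
        obtain ⟨c, rfl⟩ := (hsC.exact y).1 hy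
        obtain ⟨b, rfl⟩ := hs.surj c
        refine ⟨pA (x - ψ b), ?_⟩
        rw [hj', ← sub_eq_zero, ← map_sub, hq]
        exact ⟨-b, by simp [he]⟩
      · rintro ⟨a', ha'⟩
        obtain ⟨x', rfl⟩ := hsA.surj a'
        rw [hj'] at ha'
        rw [← hr x y, ← ha', hr, map_zero]
    · intro c'
      obtain ⟨y, rfl⟩ := hsC.surj c'
      exact ⟨q (0, y), hr 0 y⟩

end CompleteResolution

/-! ### Homological dimensions over rings whose injectives have bounded projective dimension -/

section Dimensions

variable {R : Type u} [CommRing R] {A B C M N K : ModuleCat.{u} R}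

theorem HasResolution.mono {C D : ModuleCat.{u} R → Prop} (hCD : ∀ M, C M → D M) {n : ℕ}
    (h : HasResolution C n M) : HasResolution D n M := by
  induction n generalizing M with
  | zero => exact hCD M h
  | succ n ih =>
    obtain ⟨G, K, f, g, hG, hK, h⟩ := h
    exact ⟨G, K, f, g, hCD G hG, ih hK, h⟩

theorem HasResolution.extZero {C : ModuleCat.{u} R → Prop} {n : ℕ} (h : HasResolution C n M)
    (hC : ∀ G, C G → ∀ i, ExtZero (i + 1) G N) (i : ℕ) : ExtZero (n + i + 1) M N := by
  induction n generalizing M with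
  | zero => rw [zero_add]; exact hC M h i
  | succ n ih =>
    obtain ⟨G, K, f, g, hG, hK, h1, h2, h3⟩ := h
    have := (IsSES.mk h1 h2 h3).extZero_right (ih hK) (hC G hG (n + i + 1))
    rwa [show n + 1 + i + 1 = n + i + 1 + 1 by omega]

theorem IsSyzygy.hasResolution {C : ModuleCat.{u} R → Prop} (hC : ∀ P, IsProj P → C P) {n : ℕ}
    (h : IsSyzygy n M K) (hK : C K) : HasResolution C n M := by
  induction h with
  | zero => exact hK
  | succ hl _ ih =>
    obtain ⟨P, f, g, hP, hs⟩ := hl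
    exact ⟨P, _, f, g, hC P hP, ih hK, hs.inj, hs.exact, hs.surj⟩

/-- The pushout `D` of two monomorphisms `A → A₁` and `A → A₂` with cokernels `B₁` and `B₂`. -/
theorem exists_pushout {A₁ A₂ B₁ B₂ : ModuleCat.{u} R} {f₁ : A →ₗ[R] A₁} {g₁ : A₁ →ₗ[R] B₁}
    {f₂ : A →ₗ[R] A₂} {g₂ : A₂ →ₗ[R] B₂} (h₁ : IsSES f₁ g₁) (h₂ : IsSES f₂ g₂) :
    ∃ D, Ses A₁ D B₂ ∧ Ses A₂ D B₁ := by
  let e : A →ₗ[R] A₁ × A₂ := f₁.prod (-f₂)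
  let D := (A₁ × A₂) ⧸ LinearMap.range e
  let q : A₁ × A₂ →ₗ[R] D := (LinearMap.range e).mkQ
  have hq : ∀ x, q x = 0 ↔ ∃ a, (f₁ a, -f₂ a) = x := fun x => by
    rw [Submodule.mkQ_apply, Submodule.Quotient.mk_eq_zero]; rfl
  let r₁ : D →ₗ[R] B₁ := (LinearMap.range e).liftQ (g₁ ∘ₗ LinearMap.fst R A₁ A₂) (by
    rintro _ ⟨a, rfl⟩
    simp [e, h₁.exact.apply_apply_eq_zero])
  let r₂ : D →ₗ[R] B₂ := (LinearMap.range e).liftQ (g₂ ∘ₗ LinearMap.snd R A₁ A₂) (by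
    rintro _ ⟨a, rfl⟩
    simp [e, h₂.exact.apply_apply_eq_zero])
  have hr₁ : ∀ x y, r₁ (q (x, y)) = g₁ x := fun x y => rfl
  have hr₂ : ∀ x y, r₂ (q (x, y)) = g₂ y := fun x y => rfl
  refine ⟨ModuleCat.of R D, ⟨q ∘ₗ LinearMap.inl R A₁ A₂, r₂, ?_, ?_, ?_⟩,
    q ∘ₗ LinearMap.inr R A₁ A₂, r₁, ?_, ?_, ?_⟩
  · rw [injective_iff_map_eq_zero]
    intro x hx
    obtain ⟨a, ha⟩ := (hq _).1 hx
    rw [LinearMap.inl_apply, Prod.mk.injEq, neg_eq_zero] at ha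
    rw [← ha.1, h₂.inj (ha.2.trans (map_zero _).symm), map_zero]
  · intro d
    obtain ⟨⟨x, y⟩, rfl⟩ := Submodule.mkQ_surjective _ d
    change r₂ (q (x, y)) = 0 ↔ ∃ z, q (z, 0) = q (x, y)
    rw [hr₂, h₂.exact]
    constructor
    · rintro ⟨a, rfl⟩
      refine ⟨x + f₁ a, ?_⟩
      rw [← sub_eq_zero, ← map_sub, hq]
      exact ⟨a, by simp⟩
    · rintro ⟨z, hz⟩
      rw [← h₂.exact, ← hr₂ x y, ← hz, hr₂, map_zero]
  · intro b
    obtain ⟨y, rfl⟩ := h₂.surj b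
    exact ⟨q (0, y), rfl⟩
  · rw [injective_iff_map_eq_zero]
    intro x hx
    obtain ⟨a, ha⟩ := (hq _).1 hx
    rw [LinearMap.inr_apply, Prod.mk.injEq] at ha
    rw [← ha.2, h₁.inj (ha.1.trans (map_zero _).symm), map_zero, neg_zero]
  · intro d
    obtain ⟨⟨x, y⟩, rfl⟩ := Submodule.mkQ_surjective _ d
    change r₁ (q (x, y)) = 0 ↔ ∃ z, q (0, z) = q (x, y)
    rw [hr₁, h₁.exact]
    constructor
    · rintro ⟨a, rfl⟩
      refine ⟨y + f₂ a, ?_⟩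
      rw [← sub_eq_zero, ← map_sub, hq]
      exact ⟨-a, by simp⟩
    · rintro ⟨z, hz⟩
      rw [← h₁.exact, ← hr₁ x y, ← hz, hr₁, map_zero]
  · intro b
    obtain ⟨x, rfl⟩ := h₁.surj b
    exact ⟨q (x, 0), rfl⟩

/-- The third isomorphism theorem for `H ⊆ D ⊆ P`: the quotient `N = P ⧸ H` is an extension of
`G = P ⧸ D` by `M = D ⧸ H`. -/
theorem exists_ses_quotient {H D P G : ModuleCat.{u} R} (h₁ : Ses H D M) (h₂ : Ses D P G) :
    ∃ N, Ses H P N ∧ Ses M N G := by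
  obtain ⟨c, e, h₁⟩ := h₁
  obtain ⟨j, q, h₂⟩ := h₂
  have hs := isSES_coker (j ∘ₗ c) (h₂.inj.comp h₁.inj)
  set π := (LinearMap.range (j ∘ₗ c)).mkQ
  refine ⟨_, ⟨_, _, hs⟩, ?_⟩
  have hπ : ∀ y, π (j (c y)) = 0 := fun y => hs.exact.apply_apply_eq_zero y
  obtain ⟨i, hi⟩ := h₁.exists_desc (N := ModuleCat.of R (P ⧸ LinearMap.range (j ∘ₗ c))) (π ∘ₗ j)
    (by ext y; exact hπ y)
  obtain ⟨p, hp⟩ := hs.exists_desc q (by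
    ext y
    exact h₂.exact.apply_apply_eq_zero (c y))
  have hi' : ∀ x, i (e x) = π (j x) := fun x => LinearMap.congr_fun hi x
  have hp' : ∀ x, p (π x) = q x := fun x => LinearMap.congr_fun hp x
  refine ⟨i, p, ?_, ?_, ?_⟩
  · rw [injective_iff_map_eq_zero]
    intro m hm
    obtain ⟨x, rfl⟩ := h₁.surj m
    rw [hi'] at hm
    obtain ⟨y, hy⟩ := (hs.exact _).1 hm
    rw [← h₂.inj hy, h₁.exact.apply_apply_eq_zero]
  · intro n
    obtain ⟨x, rfl⟩ := hs.surj n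
    rw [hp']
    constructor
    · intro hx
      obtain ⟨y, rfl⟩ := (h₂.exact x).1 hx
      exact ⟨e y, hi' y⟩
    · rintro ⟨m, hm⟩
      obtain ⟨y, rfl⟩ := h₁.surj m
      rw [hi'] at hm
      rw [← hp', ← hm, hp', h₂.exact.apply_apply_eq_zero]
  · intro b
    obtain ⟨x, rfl⟩ := h₂.surj b
    exact ⟨π x, hp' x⟩

/-- A module with a Gorenstein projective resolution of length `n` embeds, with Gorenstein
projective cokernel, into a module of projective dimension at most `n`. In the induction, the
embedding `K → H` of the first syzygy is pushed out along `K → G₀` to `D`. This `D` is Gorenstein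
projective, so it embeds into a projective module `P`, and `M` embeds into `P ⧸ H`. -/
theorem exists_ses_of_hasResolution {n : ℕ} (h : HasResolution IsGorensteinProjective n M) :
    ∃ H G, Ses M H G ∧ HasProjectiveDimensionLE H n ∧ IsGorensteinProjective G := by
  induction n generalizing M with
  | zero =>
    obtain ⟨M', hM', P, f, g, hP, hs⟩ := IsGorensteinProjective.exists_link h
    exact ⟨P, M', ⟨f, g, hs⟩, pdLE_zero_iff.2 hP, hM'⟩
  | succ n ih =>
    obtain ⟨G₀, K, f, g, hG₀, hK, h1, h2, h3⟩ := h
    obtain ⟨H, G, ⟨i, p, hs⟩, hH, hG⟩ := ih hK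
    obtain ⟨D, hD₁, hD₂⟩ := exists_pushout (IsSES.mk h1 h2 h3) hs
    obtain ⟨G', hG', P, j, q, hP, hsD⟩ := (isGorensteinProjective_of_ses hD₁ hG₀ hG).exists_link
    obtain ⟨N, ⟨a, b, hN⟩, hMN⟩ := exists_ses_quotient hD₂ ⟨j, q, hsD⟩
    refine ⟨N, G', hMN, hN.shortExact.hasProjectiveDimensionLT_X₃ (n + 1) hH ?_, hG'⟩
    have : HasProjectiveDimensionLT P 1 := pdLE_zero_iff.2 hP
    exact hasProjectiveDimensionLT_of_ge _ 1 _ (by omega)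

/-- The embedding of an injective module given by `exists_ses_of_hasResolution` splits. -/
theorem pdLE_of_isInj {n : ℕ} (h : HasResolution IsGorensteinProjective n M) (hM : IsInj M) :
    HasProjectiveDimensionLE M n := by
  obtain ⟨H, G, ⟨f, g, hs⟩, hH, -⟩ := exists_ses_of_hasResolution h
  obtain ⟨r, hr⟩ := hs.exists_extension (extZero_of_injective hM 0) LinearMap.id
  exact pdLE_iff.2 fun N => extZero_of_retract_left f r hr (pdLE_iff.1 hH N)

/-- Injective dimensions that are finite are bounded by the supremum of the projective dimensions of
the injective modules. -/
theorem idLE_of_idLE {n k : ℕ}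
    (hinj : ∀ I : ModuleCat.{u} R, IsInj I → HasProjectiveDimensionLE I n)
    (h : HasInjectiveDimensionLE N k) : HasInjectiveDimensionLE N n := by
  have key : ∀ t, HasInjectiveDimensionLE N (n + t) → HasInjectiveDimensionLE N n := by
    intro t
    induction t with
    | zero => exact id
    | succ t ih =>
      intro ht
      refine ih (idLE_iff.2 fun M => ?_)
      obtain ⟨I, C, f, g, hI, hs⟩ := exists_injective_ses M
      exact hs.extZero_left (extZero_of_pdLE (hinj I hI) (by omega))
        (extZero_of_idLE ht (by omega))
  exact key k (hasInjectiveDimensionLT_of_ge N (k + 1) _ (by omega))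

/-- The character module of an `n`-th syzygy of `M` is an `n`-th cosyzygy of the character module of
`M`. -/
theorem IsSyzygy.flat_of_idLE_charDual {n : ℕ} (hK : IsSyzygy n M K)
    (h : HasInjectiveDimensionLE (charDual M) n) : IsFlat K := by
  induction hK with
  | zero => exact flat_iff_injective_charDual.2 (idLE_zero_iff.1 h)
  | @succ n M M₁ K hl _ ih =>
    obtain ⟨P, f, g, hP, hs⟩ := hl
    have hP : Module.Projective R P := hP
    have : HasInjectiveDimensionLT (charDual P) 1 :=
      idLE_zero_iff.2 (flat_iff_injective_charDual.1 inferInstance)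
    exact ih (hs.charDual.shortExact.hasInjectiveDimensionLT_X₃ (n + 1)
      (hasInjectiveDimensionLT_of_ge _ 1 _ (by omega)) h)

/-- A bound for the finite projective dimensions. -/
theorem pdLE_of_pdLE {n k : ℕ}
    (hinj : ∀ I : ModuleCat.{u} R, IsInj I → HasProjectiveDimensionLE I n)
    (h : HasProjectiveDimensionLE M k) : HasProjectiveDimensionLE M (n + n) := by
  obtain ⟨K, hK⟩ := exists_isSyzygy n M
  exact hK.pdLE (pdLE_of_flat hinj
    (hK.flat_of_idLE_charDual (idLE_of_idLE hinj (idLE_charDual h))))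

/-- The `n`-th cosyzygy `C` of `N` has finite projective dimension if `N` and the injective modules
have; it satisfies `Ext^{n+j}(-, N) = Ext^j(-, C)` for `j > 0`. -/
theorem exists_cosyzygy (hinj : ∀ I : ModuleCat.{u} R, IsInj I → ∃ k, HasProjectiveDimensionLE I k)
    (hN : ∃ k, HasProjectiveDimensionLE N k) (n : ℕ) :
    ∃ C, (∃ k, HasProjectiveDimensionLE C k) ∧
      ∀ M i, ExtZero (n + i + 1) M N ↔ ExtZero (i + 1) M C := by
  induction n with
  | zero => exact ⟨N, hN, fun M i => by rw [zero_add]⟩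
  | succ n ih =>
    obtain ⟨C, ⟨k, hC⟩, h⟩ := ih
    obtain ⟨I, C', f, g, hI, hs⟩ := exists_injective_ses C
    obtain ⟨l, hl⟩ := hinj I hI
    refine ⟨C', ⟨k + l + 1, hs.shortExact.hasProjectiveDimensionLT_X₃ (k + l + 1)
      (hasProjectiveDimensionLT_of_ge _ (k + 1) _ (by omega))
      (hasProjectiveDimensionLT_of_ge _ (l + 1) _ (by omega))⟩, fun M i => ?_⟩
    rw [show n + 1 + i + 1 = n + (i + 1) + 1 by omega, h M (i + 1)]
    exact ⟨hs.zeroExt_right (extZero_of_injective hI _),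
      fun h' => hs.zeroExt_left h' (extZero_of_injective hI _)⟩

/-- If the injective modules have projective dimension at most `n`, then the projective modules have
injective dimension at most `n`. -/
theorem idLE_of_isProj {n : ℕ}
    (hinj : ∀ I : ModuleCat.{u} R, IsInj I → HasProjectiveDimensionLE I n)
    (hN : IsProj N) : HasInjectiveDimensionLE N n := by
  refine idLE_of_idLE (k := n + n) hinj (idLE_iff.2 fun M => ?_)
  have hinj' : ∀ I : ModuleCat.{u} R, IsInj I → ∃ k, HasProjectiveDimensionLE I k :=
    fun I hI => ⟨n, hinj I hI⟩
  obtain ⟨C, hC, h⟩ := exists_cosyzygy hinj' ⟨0, pdLE_zero_iff.2 hN⟩ (n + n)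
  obtain ⟨I, D, f, g, hI, hs⟩ := exists_injective_ses C
  obtain ⟨k, hk⟩ := hC
  have hD : HasProjectiveDimensionLE D (n + n) :=
    pdLE_of_pdLE hinj (k := k + n + 1) (hs.shortExact.hasProjectiveDimensionLT_X₃ (k + n + 1)
      (hasProjectiveDimensionLT_of_ge _ (k + 1) _ (by omega))
      (have := hinj I hI; hasProjectiveDimensionLT_of_ge _ (n + 1) _ (by omega)))
  -- `Ext¹(D, C) = Ext^{2n+1}(D, N) = 0`, so that `C` is a direct summand of `I`
  obtain ⟨r, hr⟩ := hs.exists_extension ((h D 0).1 (extZero_of_pdLE hD (by omega))) LinearMap.id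
  have hCI : IsInj C := ⟨fun X Y _ _ _ _ e he φ => by
    obtain ⟨ψ, hψ⟩ := hI.out e he (f ∘ₗ φ)
    refine ⟨r ∘ₗ ψ, fun x => ?_⟩
    rw [LinearMap.comp_apply, hψ]
    exact LinearMap.congr_fun hr (φ x)⟩
  exact (h M 0).2 (extZero_of_injective hCI 0)

/-- Every `n`-th syzygy embeds into a projective module with cokernel again an `n`-th syzygy, by the
horseshoe lemma applied to embeddings into injective modules. -/
theorem isGorensteinProjective_of_isSyzygy {n : ℕ}
    (hinj : ∀ I : ModuleCat.{u} R, IsInj I → HasProjectiveDimensionLE I n)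
    (hK : IsSyzygy n M K) : IsGorensteinProjective K := by
  refine isGorensteinProjective_of_coinduction (fun K => ∃ M, IsSyzygy n M K) ?_ ?_ ⟨M, hK⟩
  · rintro K ⟨M, hK⟩ Q hQ i
    exact hK.extZero (extZero_of_idLE (idLE_of_isProj hinj hQ) (by omega))
  · rintro K ⟨M, hK⟩
    obtain ⟨I, C, f, g, hI, hs⟩ := exists_injective_ses M
    obtain ⟨L, K', hL, hK', f', g', hs'⟩ := hK.exists_horseshoe ⟨f, g, hs⟩
    exact ⟨K', ⟨C, hK'⟩, L, f', g', hL.projective (hinj I hI), hs'⟩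

end Dimensions

/-! ### Global dimensions -/

section GlobalDimensions

variable {R : Type u} [CommRing R] {M : ModuleCat.{u} R}

theorem iInf_natCast_le_iff {p : ℕ → Prop} {N : ℕ} :
    (⨅ (n : ℕ) (_ : p n), (n : ℕ∞)) ≤ N ↔ ∃ n ≤ N, p n := by
  constructor
  · intro h
    by_contra! hp
    have : ((N + 1 : ℕ) : ℕ∞) ≤ ⨅ (n : ℕ) (_ : p n), (n : ℕ∞) :=
      le_iInf₂ fun n hn => Nat.cast_le.2 (by by_contra hlt; exact hp n (by omega) hn)
    exact absurd (Nat.cast_le.1 (this.trans h)) (by omega)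
  · rintro ⟨n, hn, hpn⟩
    exact (iInf₂_le n hpn).trans (Nat.cast_le.2 hn)

theorem Ggldim_le_iff {n : ℕ} : Ggldim R ≤ n ↔
    ∀ M : ModuleCat.{u} R, ∃ j ≤ n, HasResolution IsGorensteinProjective j M :=
  iSup_le_iff.trans (forall_congr' fun _ => iInf_natCast_le_iff)

theorem Gwdim_le_iff {n : ℕ} : Gwdim R ≤ n ↔
    ∀ M : ModuleCat.{u} R, ∃ j ≤ n, HasResolution IsGorensteinFlat j M :=
  iSup_le_iff.trans (forall_congr' fun _ => iInf_natCast_le_iff)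

theorem extZero_of_flat_of_le {j n : ℕ} (hjn : j ≤ n)
    (h : ∀ F : ModuleCat.{u} R, IsFlat F → ExtZero (j + 1) F M) :
    ∀ F : ModuleCat.{u} R, IsFlat F → ExtZero (n + 1) F M := by
  induction n, hjn using Nat.le_induction with
  | base => exact h
  | succ n _ ih =>
    intro F hF
    obtain ⟨K, P, f, g, hP, hs⟩ := exists_link_isProj F
    exact hs.extZero_right (ih K (link_flat_left ⟨P, f, g, hP, hs⟩ hF))
      (extZero_of_projective hP _)

/-- The global cotorsion dimension is the supremum of the projective dimensions of the flat
modules. -/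
theorem cotD_le_iff {n : ℕ} : cotD R ≤ n ↔
    ∀ F : ModuleCat.{u} R, IsFlat F → HasProjectiveDimensionLE F n := by
  refine iSup_le_iff.trans ((forall_congr' fun _ => iInf_natCast_le_iff).trans ⟨?_, ?_⟩)
  · intro h F hF
    refine pdLE_iff.2 fun N => ?_
    obtain ⟨j, hj, hN⟩ := h N
    exact extZero_of_flat_of_le hj hN F hF
  · exact fun h N => ⟨n, le_rfl, fun F hF => pdLE_iff.1 (h F hF) N⟩

theorem pdLE_of_isInj_of_Ggldim_le {n : ℕ} (h : Ggldim R ≤ n) (I : ModuleCat.{u} R)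
    (hI : IsInj I) : HasProjectiveDimensionLE I n := by
  obtain ⟨j, hj, hres⟩ := Ggldim_le_iff.1 h I
  have := pdLE_of_isInj hres hI
  exact hasProjectiveDimensionLT_of_ge _ (j + 1) _ (by omega)

theorem Ggldim_le_of_pdLE {n : ℕ}
    (hinj : ∀ I : ModuleCat.{u} R, IsInj I → HasProjectiveDimensionLE I n) : Ggldim R ≤ n :=
  Ggldim_le_iff.2 fun M => by
    obtain ⟨K, hK⟩ := exists_isSyzygy n M
    exact ⟨n, le_rfl, hK.hasResolution (fun _ => isGorensteinProjective_of_isProj)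
      (isGorensteinProjective_of_isSyzygy hinj hK)⟩

/-- Gorenstein flat modules have vanishing `Ext` into `I⁺`; shift along a resolution. -/
theorem idLE_charDual_of_Gwdim_le {m : ℕ} (h : Gwdim R ≤ m) {I : ModuleCat.{u} R} (hI : IsInj I) :
    HasInjectiveDimensionLE (charDual I) m :=
  idLE_iff.2 fun M => by
    obtain ⟨j, hj, hres⟩ := Gwdim_le_iff.1 h M
    have := hres.extZero (fun G hG => hG.extZero hI) (m - j)
    rwa [Nat.add_sub_cancel' hj] at this

variable (R)

theorem cotD_le_Ggldim : cotD R ≤ Ggldim R := by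
  cases h : Ggldim R with
  | top => exact le_top
  | coe n =>
    exact cotD_le_iff.2 fun F hF => pdLE_of_flat (pdLE_of_isInj_of_Ggldim_le h.le) hF

theorem Ggldim_le_add : Ggldim R ≤ Gwdim R + cotD R := by
  cases hm : Gwdim R with
  | top => simp
  | coe m =>
    cases hk : cotD R with
    | top => simp
    | coe k =>
      rw [← Nat.cast_add]
      refine Ggldim_le_of_pdLE fun I hI => ?_
      obtain ⟨K, hK⟩ := exists_isSyzygy m I
      exact hK.pdLE (cotD_le_iff.1 hk.le K
        (hK.flat_of_idLE_charDual (idLE_charDual_of_Gwdim_le hm.le hI)))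

theorem cotD_eq_zero_iff : cotD R = 0 ↔ IsPerfect R := by
  rw [← nonpos_iff_eq_zero, ← Nat.cast_zero, cotD_le_iff]
  exact forall₂_congr fun F _ => pdLE_zero_iff

theorem Gwdim_le_Ggldim : Gwdim R ≤ Ggldim R := by
  cases h : Ggldim R with
  | top => exact le_top
  | coe n =>
    refine Gwdim_le_iff.2 fun M => ?_
    obtain ⟨j, hj, hres⟩ := Ggldim_le_iff.1 h.le M
    exact ⟨j, hj, hres.mono fun _ => fun hG =>
      hG.isGorensteinFlat (pdLE_of_isInj_of_Ggldim_le h.le)⟩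

theorem Gwdim_eq_zero_iff : Gwdim R = 0 ↔ IsIF R := by
  rw [← nonpos_iff_eq_zero, ← Nat.cast_zero]
  refine ⟨fun h I hI => ?_, fun h => Gwdim_le_iff.2 fun M =>
    ⟨0, le_rfl, isGorensteinFlat_of_isIF h M⟩⟩
  exact flat_iff_injective_charDual.2 (idLE_zero_iff.1 (idLE_charDual_of_Gwdim_le h hI))

end GlobalDimensions

end GorensteinDim


theorem theorem2p1 (R : Type u) [CommRing R] :
    GorensteinDim.cotD R ≤ GorensteinDim.Ggldim R ∧
    (GorensteinDim.IsCoherent R →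
      GorensteinDim.Ggldim R ≤ GorensteinDim.Gwdim R + GorensteinDim.cotD R ∧
      (GorensteinDim.cotD R = 0 ↔ GorensteinDim.IsPerfect R) ∧
      (GorensteinDim.IsPerfect R → GorensteinDim.Gwdim R = GorensteinDim.Ggldim R) ∧
      (GorensteinDim.Gwdim R = 0 ↔ GorensteinDim.IsIF R) ∧
      (GorensteinDim.IsIF R → GorensteinDim.cotD R = GorensteinDim.Ggldim R)) := by
  have h₁ := GorensteinDim.cotD_le_Ggldim R
  have h₂ := GorensteinDim.Ggldim_le_add R
  refine ⟨h₁, fun _ => ⟨h₂, GorensteinDim.cotD_eq_zero_iff R, fun h => ?_,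
    GorensteinDim.Gwdim_eq_zero_iff R, fun h => ?_⟩⟩
  · rw [(GorensteinDim.cotD_eq_zero_iff R).2 h, add_zero] at h₂
    exact (GorensteinDim.Gwdim_le_Ggldim R).antisymm h₂
  · rw [(GorensteinDim.Gwdim_eq_zero_iff R).2 h, zero_add] at h₂
    exact h₁.antisymm h₂
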